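/- Let $n\ge 1$, $\gamma\in[1,2)$, and let $u_0\in H^1(\mathbb R^n)\cap L^\gamma(\mathbb R^n)$ with $u_0\ge 0$ a.e. Put $Q=\mathbb R^n\times(0,\infty)$ and $Q_r^+=B_r\times(0,r^2)$ for $r>0$. Let $\mathcal U=\bigcap_{r>0}H^1(Q_r^+)$ be the space of functions $u$ on $Q$ such that $u$ and its weak derivatives $\partial_t u,\partial_1u,\dots,\partial_n u$ belong to $L^2(Q_r^+)$ for every $r>0$, and let $\mathcal U_0=\{u\in\mathcal U: u|_{t=0}=u_0\text{ in the sense of traces}\}$. For $\varepsilon\in(0,1)$ and $w\in\mathcal U$ let $$\mathcal E_\varepsilon(w)=\int_0^\infty\frac{e^{-t/\varepsilon}}{\varepsilon}\left(\int_{\mathbb R^n}\varepsilon|\partial_t w|^2+|\nabla w|^2\,dx+2\int_{\mathbb R^n}w_+^\gamma\,dx\right)dt\in[0,\infty].$$ Let $\{u_\varepsilon\}_{\varepsilon\in(0,1)}\subset\mathcal U_0$ be a family such that, for every $\varepsilon\in(0,1)$, $u_\varepsilon$ minimizes $\mathcal E_\varepsilon$ over $\mathcal U_0$. Then there exist $u\in\mathcal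 U_0$ and a sequence $\varepsilon_j\in(0,1)$ with $\varepsilon_j\to0$ such that $$u_{\varepsilon_j}\rightharpoonup u\ \text{ weakly in }\mathcal U\qquad\text{and}\qquad u_{\varepsilon_j}\to u\ \text{ in }L^2_{\mathrm{loc}}(Q),$$ that is, $u_{\varepsilon_j}\rightharpoonup u$ weakly in $H^1(Q_r^+)$ for every $r>0$, and $u_{\varepsilon_j}\to u$ in $L^2(K)$ for every compact $K\subset Q$. -/

import Mathlib

open MeasureTheory Set Filter Topology
open scoped ENNReal ContDiff

namespace EllipticRegularization

noncomputable section

/-- `g` is the weak derivative of `u` in the direction `e` on the open set `Ω`: both functions are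
locally integrable on `Ω`, and `∫_Ω u ∂ₑφ = - ∫_Ω g φ` for every `φ ∈ C_c^∞(Ω)`. -/
def IsWeakDeriv {V : Type*} [NormedAddCommGroup V] [NormedSpace ℝ V] [MeasureSpace V]
    (Ω : Set V) (e : V) (u g : V → ℝ) : Prop :=
  LocallyIntegrableOn u Ω volume ∧ LocallyIntegrableOn g Ω volume ∧
    ∀ φ : V → ℝ, ContDiff ℝ ∞ φ → HasCompactSupport φ → tsupport φ ⊆ Ω →
      ∫ z in Ω, u z * fderiv ℝ φ z e = - ∫ z in Ω, g z * φ z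

open Classical in
/-- The weak derivative of `u` in the direction `e` on `Ω` (unique up to a null set of `Ω` when it
exists; the zero function when it does not exist). -/
def weakDeriv {V : Type*} [NormedAddCommGroup V] [NormedSpace ℝ V] [MeasureSpace V]
    (Ω : Set V) (e : V) (u : V → ℝ) : V → ℝ :=
  if h : ∃ g, IsWeakDeriv Ω e u g then h.choose else 0

theorem isWeakDeriv_weakDeriv {V : Type*} [NormedAddCommGroup V] [NormedSpace ℝ V]
    [MeasureSpace V] {Ω : Set V} {e : V} {u : V → ℝ} (h : ∃ g, IsWeakDeriv Ω e u g) :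
    IsWeakDeriv Ω e u (weakDeriv Ω e u) := by
  unfold weakDeriv
  rw [dif_pos h]
  exact h.choose_spec

/-- The space `ℝⁿ` with its Euclidean norm. -/
abbrev Space (n : ℕ) : Type := EuclideanSpace ℝ (Fin n)

/-- The `i`-th standard basis vector of `ℝⁿ`. -/
def basisVec {n : ℕ} (i : Fin n) : Space n := EuclideanSpace.single i 1

/-- `u₀ ∈ H¹(ℝⁿ)`. -/
def MemH1 {n : ℕ} (u₀ : Space n → ℝ) : Prop :=
  MemLp u₀ 2 volume ∧ ∀ i : Fin n, ∃ g : Space n → ℝ,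
    IsWeakDeriv univ (basisVec i) u₀ g ∧ MemLp g 2 volume

/-- The half space `Q = ℝⁿ × (0, ∞)`. -/
def Q (n : ℕ) : Set (Space n × ℝ) := univ ×ˢ Ioi 0

/-- The cylinder `Q_r⁺ = B_r × (0, r²)`. -/
def Qplus (n : ℕ) (r : ℝ) : Set (Space n × ℝ) := Metric.ball 0 r ×ˢ Ioo 0 (r ^ 2)

/-- The weak time derivative `∂ₜ u` on `Q`. -/
def dt {n : ℕ} (u : Space n × ℝ → ℝ) : Space n × ℝ → ℝ :=
  weakDeriv (Q n) ((0 : Space n), (1 : ℝ)) u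

/-- The weak spatial partial derivative `∂ᵢ u` on `Q`. -/
def dx {n : ℕ} (i : Fin n) (u : Space n × ℝ → ℝ) : Space n × ℝ → ℝ :=
  weakDeriv (Q n) (basisVec i, (0 : ℝ)) u

/-- The space `𝓤 = ⋂_{r > 0} H¹(Q_r⁺)`: `u` and its weak derivatives `∂ₜ u`, `∂ᵢ u` on `Q` exist and
lie in `L²(Q_r⁺)` for every `r > 0`. Values of `u` outside `Q` are irrelevant. -/
def USpace (n : ℕ) : Set (Space n × ℝ → ℝ) :=
  {u | (∀ r : ℝ, 0 < r → MemLp u 2 (volume.restrict (Qplus n r))) ∧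
    (∃ g, IsWeakDeriv (Q n) ((0 : Space n), (1 : ℝ)) u g ∧
      ∀ r : ℝ, 0 < r → MemLp g 2 (volume.restrict (Qplus n r))) ∧
    ∀ i : Fin n, ∃ g, IsWeakDeriv (Q n) (basisVec i, (0 : ℝ)) u g ∧
      ∀ r : ℝ, 0 < r → MemLp g 2 (volume.restrict (Qplus n r))}

/-- `u|_{t = 0} = u₀` in the sense of traces, expressed by Green's formula
`∫_Q u ∂ₜφ = - ∫_Q (∂ₜ u) φ - ∫_{ℝⁿ} u₀ φ(·, 0)` for all `φ ∈ C_c^∞(ℝⁿ × ℝ)`; the test functions need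
not vanish on `{t = 0}`. -/
def HasInitialTrace {n : ℕ} (u : Space n × ℝ → ℝ) (u₀ : Space n → ℝ) : Prop :=
  ∀ φ : Space n × ℝ → ℝ, ContDiff ℝ ∞ φ → HasCompactSupport φ →
    ∫ z in Q n, u z * fderiv ℝ φ z ((0 : Space n), (1 : ℝ)) =
      - (∫ z in Q n, dt u z * φ z) - ∫ x, u₀ x * φ (x, 0)

/-- The space `𝓤₀` of all `u ∈ 𝓤` with `u|_{t = 0} = u₀`. -/
def USpace₀ {n : ℕ} (u₀ : Space n → ℝ) : Set (Space n × ℝ → ℝ) :=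
  {u | u ∈ USpace n ∧ HasInitialTrace u u₀}

/-- The functional `𝓔_ε` with values in `[0, ∞]`. -/
def energy {n : ℕ} (γ ε : ℝ) (w : Space n × ℝ → ℝ) : ℝ≥0∞ :=
  ∫⁻ t in Ioi (0 : ℝ), ENNReal.ofReal (Real.exp (-t / ε) / ε) *
    ((∫⁻ x : Space n, ENNReal.ofReal (ε * dt w (x, t) ^ 2 + ∑ i, dx i w (x, t) ^ 2)) +
      2 * ∫⁻ x : Space n, ENNReal.ofReal (max (w (x, t)) 0 ^ γ))

/-- `u` is an (absolute) minimizer of `𝓔_ε` in `𝓤₀`. -/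
def IsMinimizer {n : ℕ} (γ ε : ℝ) (u₀ : Space n → ℝ) (u : Space n × ℝ → ℝ) : Prop :=
  u ∈ USpace₀ u₀ ∧ ∀ w ∈ USpace₀ u₀, energy γ ε u ≤ energy γ ε w

/-- `f_j ⇀ f` weakly in `L²(A)`. -/
def TendstoWeakL2 {n : ℕ} (A : Set (Space n × ℝ)) (f : ℕ → Space n × ℝ → ℝ)
    (f' : Space n × ℝ → ℝ) : Prop :=
  ∀ g : Space n × ℝ → ℝ, MemLp g 2 (volume.restrict A) →
    Tendsto (fun j => ∫ z in A, f j z * g z) atTop (𝓝 (∫ z in A, f' z * g z))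

/-- `u_j ⇀ u` weakly in `𝓤`, that is, weakly in `H¹(Q_r⁺)` for every `r > 0`: the functions and all
their first order weak derivatives converge weakly in `L²(Q_r⁺)`. -/
def TendstoWeakU {n : ℕ} (u : ℕ → Space n × ℝ → ℝ) (u' : Space n × ℝ → ℝ) : Prop :=
  ∀ r : ℝ, 0 < r →
    TendstoWeakL2 (Qplus n r) u u' ∧
    TendstoWeakL2 (Qplus n r) (fun j => dt (u j)) (dt u') ∧
    ∀ i : Fin n, TendstoWeakL2 (Qplus n r) (fun j => dx i (u j)) (dx i u')

/-- `u_j → u` in `L²_loc(Q)`: convergence in `L²(K)` for every compact `K ⊆ Q`. -/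
def TendstoL2loc {n : ℕ} (u : ℕ → Space n × ℝ → ℝ) (u' : Space n × ℝ → ℝ) : Prop :=
  ∀ K : Set (Space n × ℝ), IsCompact K → K ⊆ Q n →
    Tendsto (fun j => eLpNorm (u j - u') 2 (volume.restrict K)) atTop (𝓝 0)

end

end EllipticRegularization

open EllipticRegularization

/-!
Elliptic regularization: the minimizers `u_ε` of the weighted energies have a subsequence that
converges weakly in `𝓤` and strongly in `L²_loc(Q)`. The point is an energy estimate that is uniform
in `ε`; the rest is compactness.

**Energy estimate** (`IsMinimizer.lintegral_slab_le`). The initial datum, extended constantly in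
time, is a competitor whose energy `C` does not depend on `ε`, so `𝓔_ε(u_ε) ≤ C`. By itself this
controls only the times `t ≲ ε`. For later times, `u = u_ε` is compared with its delayed copy
`w(x, ζ(s)) = u(x, s)`, where `ζ(s) = s + l ε (e^{s/ε} - 2 + e^{s/ε - s})`. As `ζ` is a smooth
diffeomorphism of `ℝ` fixing `0`, the copy `w` has the same initial trace, and its derivatives are
explicit (`TimeChange.comp_symm_mem_USpace₀`, `TimeChange.energy_comp_symm`); slices of `u` at fixed
times are not needed. After changing variables back to `s`, the weights in `𝓔_ε(w)` are at most
`1 + 4 l` times those in `𝓔_ε(u)`, minus `(l / 2) e^{-s}` as long as `l e^{s/ε} ≤ 1/4`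
(`delay_kinetic_weight_le`, `delay_static_weight_le`). To first order in `l` this is the inner
variation of `𝓔_ε` along the displacement `ζ(s) - s`, chosen so that the coefficient of the static
density is positive only near `t = 0`. Minimality and `l = e^{-S/ε} / 4` then give
`∫_{0 < t < S} |∂ₜu|² + |∇u|² + 2 u₊^γ ≤ 8 C e^S`.

**Bound on `u` itself** (`lintegral_slab_sq_le`). The trace condition says that `u`, extended by
`u₀` to negative times, has a weak time derivative on all of `ℝⁿ × ℝ` without singular part at `t =
0`. The fundamental theorem of calculus for weak derivatives (`IsWeakDeriv.ae_translate`), used over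
a translation by `-T`, bounds `u - u₀` in `L²` by `∂ₜu`.

**Weak limit** (`exists_subseq_tendsto_jet`). All bounds grow at most exponentially in time, so
`e^{-2t} u_ε` and the same multiples of the derivatives are bounded in `L²(Q)`, and sequential
Banach–Alaoglu applies once, without a diagonal argument. Weak derivatives and the trace condition
are tested against fixed functions and pass to the limit.

**Strong limit** (`tendsto_lintegral_sq_of_tendstoWeakL2`). For `f_j = u_{ε_j} - v`, which is weakly
null, the averages of `f_j` over small translates tend to `0` pointwise and boundedly, while `f_j`
differs from its averages in `L²(K)` by at most the size of the translates times the norm of the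
gradient.
-/

set_option linter.unusedSectionVars false

namespace EllipticRegularization

/-! ### Square integrals -/

/-- Cauchy–Schwarz against the constant function `1`. -/
theorem enorm_integral_sq_le {α : Type*} [MeasurableSpace α] {μ : Measure α} {f : α → ℝ}
    (hf : AEStronglyMeasurable f μ) :
    ‖∫ x, f x ∂μ‖ₑ ^ 2 ≤ μ univ * ∫⁻ x, ‖f x‖ₑ ^ 2 ∂μ := by
  have h1 : ‖∫ x, f x ∂μ‖ₑ ≤ ∫⁻ x, ‖f x‖ₑ ∂μ := enorm_integral_le_lintegral_enorm f
  have h2 := ENNReal.lintegral_mul_le_Lp_mul_Lq μ Real.HolderConjugate.two_two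
    hf.enorm (aemeasurable_const (b := (1 : ℝ≥0∞)))
  simp only [Pi.mul_apply, mul_one, ENNReal.one_rpow, lintegral_const, one_mul] at h2
  calc ‖∫ x, f x ∂μ‖ₑ ^ 2 ≤ ((∫⁻ x, ‖f x‖ₑ ^ (2 : ℝ) ∂μ) ^ (1 / 2 : ℝ) * μ univ ^ (1 / 2 : ℝ)) ^ 2 := by
        gcongr; exact h1.trans h2
    _ = μ univ * ∫⁻ x, ‖f x‖ₑ ^ 2 ∂μ := by
        rw [mul_pow, ← ENNReal.rpow_natCast, ← ENNReal.rpow_natCast, ← ENNReal.rpow_mul,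
          ← ENNReal.rpow_mul]
        norm_num [mul_comm]

theorem enorm_sq_eq_ofReal (x : ℝ) : ‖x‖ₑ ^ 2 = ENNReal.ofReal (x ^ 2) := by
  rw [← ofReal_norm, ← ENNReal.ofReal_pow (norm_nonneg _), Real.norm_eq_abs, sq_abs]

theorem enorm_add_sq_le (x y : ℝ) : ‖x + y‖ₑ ^ 2 ≤ 2 * ‖x‖ₑ ^ 2 + 2 * ‖y‖ₑ ^ 2 := by
  simp only [enorm_sq_eq_ofReal]
  have : (2 : ℝ≥0∞) = ENNReal.ofReal 2 := by simp
  rw [this, ← ENNReal.ofReal_mul (by norm_num), ← ENNReal.ofReal_mul (by norm_num),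
    ← ENNReal.ofReal_add (by positivity) (by positivity)]
  exact ENNReal.ofReal_le_ofReal (by nlinarith [sq_nonneg (x - y)])

theorem eLpNorm_two_eq {α : Type*} [MeasurableSpace α] {μ : Measure α} (f : α → ℝ) :
    eLpNorm f 2 μ = (∫⁻ x, ‖f x‖ₑ ^ 2 ∂μ) ^ (1 / 2 : ℝ) := by
  rw [eLpNorm_eq_lintegral_rpow_enorm_toReal (by simp) (by simp)]
  simp

theorem lintegral_enorm_sq_ne_top_of_memLp {α : Type*} [MeasurableSpace α] {μ : Measure α} {f : α → ℝ}
    (hf : MemLp f 2 μ) : ∫⁻ x, ‖f x‖ₑ ^ 2 ∂μ ≠ ⊤ := by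
  have := lintegral_rpow_enorm_lt_top_of_eLpNorm_lt_top (by simp) (by simp) hf.2
  simp only [ENNReal.toReal_ofNat, ENNReal.rpow_ofNat] at this
  exact this.ne

/-! ### Weak derivatives -/

section WeakDerivatives

variable {V : Type*} [NormedAddCommGroup V] [NormedSpace ℝ V] [FiniteDimensional ℝ V]
  [MeasureSpace V] [BorelSpace V] [(volume : Measure V).IsAddHaarMeasure] {Ω : Set V}

theorem integrable_mul_of_tsupport_subset {f φ : V → ℝ}
    (hf : LocallyIntegrableOn f Ω volume) (hφ : Continuous φ) (hc : HasCompactSupport φ)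
    (hs : tsupport φ ⊆ Ω) : Integrable (fun z => f z * φ z) (volume.restrict Ω) := by
  have h1 : IntegrableOn (fun z => f z * φ z) (tsupport φ) volume :=
    (hf.integrableOn_compact_subset hs hc).mul_continuousOn hφ.continuousOn hc
  rw [integrableOn_iff_integrable_of_support_subset] at h1
  · exact h1.restrict
  · intro z hz
    apply subset_tsupport
    intro h
    exact hz (by simp [h])

/-- Weak derivatives are unique almost everywhere. -/
theorem IsWeakDeriv.ae_eq (hΩ : IsOpen Ω) {e : V} {u g₁ g₂ : V → ℝ}
    (h₁ : IsWeakDeriv Ω e u g₁) (h₂ : IsWeakDeriv Ω e u g₂) :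
    g₁ =ᵐ[volume.restrict Ω] g₂ := by
  have key := hΩ.ae_eq_zero_of_integral_contDiff_smul_eq_zero (μ := volume)
    (h₁.2.1.sub h₂.2.1) ?_
  · rw [EventuallyEq, ae_restrict_iff' hΩ.measurableSet]
    filter_upwards [key] with x hx hxΩ
    exact sub_eq_zero.1 (hx hxΩ)
  · intro φ hφ hc hs
    have e1 := h₁.2.2 φ hφ hc hs
    have e2 := h₂.2.2 φ hφ hc hs
    have i1 := integrable_mul_of_tsupport_subset h₁.2.1 hφ.continuous hc hs
    have i2 := integrable_mul_of_tsupport_subset h₂.2.1 hφ.continuous hc hs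
    have : ∫ z in Ω, (φ z • (g₁ - g₂) z) = 0 := by
      have : ∀ z, φ z • (g₁ - g₂) z = g₁ z * φ z - g₂ z * φ z := by
        intro z; simp; ring
      simp_rw [this]
      rw [integral_sub i1 i2]; linarith
    rw [← this, setIntegral_eq_integral_of_forall_compl_eq_zero]
    intro x hx
    rw [image_eq_zero_of_notMem_tsupport (fun h => hx (hs h))]; simp

theorem IsWeakDeriv.congr_right (hΩ : IsOpen Ω) {e : V} {u g g' : V → ℝ}
    (h : IsWeakDeriv Ω e u g) (hg : g =ᵐ[volume.restrict Ω] g') : IsWeakDeriv Ω e u g' := by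
  refine ⟨h.1, ?_, fun φ hφ hc hs => ?_⟩
  · rw [locallyIntegrableOn_iff hΩ.isLocallyClosed] at *
    intro k hk hkc
    have := (locallyIntegrableOn_iff hΩ.isLocallyClosed).1 h.2.1 k hk hkc
    exact this.congr (ae_mono (Measure.restrict_mono hk le_rfl) hg)
  · rw [h.2.2 φ hφ hc hs]
    congr 1
    apply integral_congr_ae
    filter_upwards [hg] with z hz
    rw [hz]

theorem IsWeakDeriv.congr_left {e : V} {u u' g : V → ℝ} (h : IsWeakDeriv Ω e u g)
    (hu : u =ᵐ[volume.restrict Ω] u') (hu' : LocallyIntegrableOn u' Ω volume) :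
    IsWeakDeriv Ω e u' g := by
  refine ⟨hu', h.2.1, fun φ hφ hc hs => ?_⟩
  rw [← h.2.2 φ hφ hc hs]
  apply integral_congr_ae
  filter_upwards [hu] with z hz
  rw [hz]

theorem hasCompactSupport_fderiv_apply {φ : V → ℝ} (hc : HasCompactSupport φ) (e : V) :
    HasCompactSupport (fun z => fderiv ℝ φ z e) :=
  hc.fderiv_apply (𝕜 := ℝ) e

theorem continuous_fderiv_apply_const {φ : V → ℝ} (hφ : ContDiff ℝ ∞ φ) (e : V) :
    Continuous (fun z => fderiv ℝ φ z e) :=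
  (hφ.continuous_fderiv (by simp)).clm_apply continuous_const

theorem IsWeakDeriv.integrable_left {e : V} {u g : V → ℝ}
    (h : IsWeakDeriv Ω e u g) {φ : V → ℝ} (hφ : ContDiff ℝ ∞ φ) (hc : HasCompactSupport φ)
    (hs : tsupport φ ⊆ Ω) (e' : V) :
    Integrable (fun z => u z * fderiv ℝ φ z e') (volume.restrict Ω) :=
  integrable_mul_of_tsupport_subset h.1 (continuous_fderiv_apply_const hφ e')
    (hasCompactSupport_fderiv_apply hc e') ((tsupport_fderiv_apply_subset ℝ e').trans hs)

theorem IsWeakDeriv.sub {e : V} {u₁ u₂ g₁ g₂ : V → ℝ}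
    (h₁ : IsWeakDeriv Ω e u₁ g₁) (h₂ : IsWeakDeriv Ω e u₂ g₂) :
    IsWeakDeriv Ω e (u₁ - u₂) (g₁ - g₂) := by
  refine ⟨h₁.1.sub h₂.1, h₁.2.1.sub h₂.2.1, fun φ hφ hc hs => ?_⟩
  simp only [Pi.sub_apply, sub_mul]
  rw [integral_sub (h₁.integrable_left hφ hc hs e) (h₂.integrable_left hφ hc hs e),
    integral_sub (integrable_mul_of_tsupport_subset h₁.2.1 hφ.continuous hc hs)
      (integrable_mul_of_tsupport_subset h₂.2.1 hφ.continuous hc hs),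
    h₁.2.2 φ hφ hc hs, h₂.2.2 φ hφ hc hs]
  ring

theorem IsWeakDeriv.add_dir {e₁ e₂ : V} {u g₁ g₂ : V → ℝ}
    (h₁ : IsWeakDeriv Ω e₁ u g₁) (h₂ : IsWeakDeriv Ω e₂ u g₂) :
    IsWeakDeriv Ω (e₁ + e₂) u (g₁ + g₂) := by
  refine ⟨h₁.1, h₁.2.1.add h₂.2.1, fun φ hφ hc hs => ?_⟩
  simp only [Pi.add_apply, map_add, mul_add, add_mul]
  rw [integral_add (h₁.integrable_left hφ hc hs e₁) (h₁.integrable_left hφ hc hs e₂),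
    integral_add (integrable_mul_of_tsupport_subset h₁.2.1 hφ.continuous hc hs)
      (integrable_mul_of_tsupport_subset h₂.2.1 hφ.continuous hc hs),
    h₁.2.2 φ hφ hc hs, h₂.2.2 φ hφ hc hs]
  ring

theorem IsWeakDeriv.smul_dir {e : V} {u g : V → ℝ} (h : IsWeakDeriv Ω e u g) (c : ℝ) :
    IsWeakDeriv Ω (c • e) u (fun z => c * g z) := by
  refine ⟨h.1, by simpa [Pi.smul_def] using h.2.1.smul c, fun φ hφ hc hs => ?_⟩
  simp only [map_smul, smul_eq_mul]
  have e1 : ∀ z, u z * (c * fderiv ℝ φ z e) = c * (u z * fderiv ℝ φ z e) := by intro z; ring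
  simp_rw [e1, mul_assoc]
  rw [integral_const_mul, integral_const_mul, h.2.2 φ hφ hc hs]; ring

theorem IsWeakDeriv.zero_dir {u : V → ℝ} (h : LocallyIntegrableOn u Ω volume) :
    IsWeakDeriv Ω 0 u 0 := by
  refine ⟨h, locallyIntegrableOn_zero, fun φ hφ hc hs => ?_⟩
  simp

theorem IsWeakDeriv.sum_dir {ι : Type*} (s : Finset ι) {e : ι → V} {u : V → ℝ}
    {g : ι → V → ℝ} (hu : LocallyIntegrableOn u Ω volume)
    (h : ∀ i, IsWeakDeriv Ω (e i) u (g i)) : IsWeakDeriv Ω (∑ i ∈ s, e i) u (∑ i ∈ s, g i) := by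
  classical
  induction s using Finset.induction_on with
  | empty => simpa using IsWeakDeriv.zero_dir hu
  | insert a s ha ih =>
    rw [Finset.sum_insert ha, Finset.sum_insert ha]
    exact (h a).add_dir ih

end WeakDerivatives

/-! ### Translations of weakly differentiable functions -/

section Translation

variable {V : Type*} [NormedAddCommGroup V] [NormedSpace ℝ V] [FiniteDimensional ℝ V]
  [MeasureSpace V] [BorelSpace V] [(volume : Measure V).IsAddHaarMeasure] {Ω : Set V}

theorem setLIntegral_comp_add_le {A B : Set V} (hA : MeasurableSet A) (hB : MeasurableSet B) {c : V}
    (h : ∀ z ∈ A, z + c ∈ B) (F : V → ℝ≥0∞) : ∫⁻ z in A, F (z + c) ≤ ∫⁻ z in B, F z := by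
  calc ∫⁻ z in A, F (z + c) = ∫⁻ z in A, B.indicator F (z + c) :=
        setLIntegral_congr_fun hA fun z hz => by
          simp only [indicator_of_mem (h z hz)]
    _ ≤ ∫⁻ z, B.indicator F (z + c) := setLIntegral_le_lintegral _ _
    _ = ∫⁻ z, B.indicator F z := lintegral_add_right_eq_self _ c
    _ = ∫⁻ z in B, F z := lintegral_indicator hB F

/-- Joint integrability of `(z, s) ↦ g (z + s h)`, the input to Fubini's theorem below. -/
theorem integrable_comp_add_smul {h : V}
    (hh : ∀ z ∈ Ω, ∀ s ∈ Icc (0 : ℝ) 1, z + s • h ∈ Ω) {g : V → ℝ} (hg : Measurable g)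
    (hgi : LocallyIntegrableOn g Ω volume) {A : Set V} (hA : IsCompact A) (hAΩ : A ⊆ Ω) :
    Integrable (fun p : V × ℝ => g (p.1 + p.2 • h))
      ((volume.restrict A).prod (volume.restrict (Ioc (0 : ℝ) 1))) := by
  have hm : Measurable (fun p : V × ℝ => g (p.1 + p.2 • h)) := by
    apply hg.comp
    have : Continuous (fun p : V × ℝ => p.1 + p.2 • h) := by fun_prop
    exact this.measurable
  refine ⟨hm.aestronglyMeasurable, ?_⟩
  set C : Set V := (fun p : V × ℝ => p.1 + p.2 • h) '' (A ×ˢ Icc (0 : ℝ) 1) with hC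
  have hCc : IsCompact C := (hA.prod isCompact_Icc).image (by fun_prop)
  have hCΩ : C ⊆ Ω := by
    rintro _ ⟨p, hp, rfl⟩
    exact hh p.1 (hAΩ hp.1) p.2 hp.2
  have hfin := (hgi.integrableOn_compact_subset hCΩ hCc).2
  rw [hasFiniteIntegral_iff_enorm] at hfin ⊢
  rw [lintegral_prod_symm _ hm.enorm.aemeasurable]
  calc ∫⁻ s in Ioc (0 : ℝ) 1, ∫⁻ z in A, ‖g (z + s • h)‖ₑ
      ≤ ∫⁻ s in Ioc (0 : ℝ) 1, ∫⁻ z in C, ‖g z‖ₑ := by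
        apply setLIntegral_mono' measurableSet_Ioc
        intro s hs
        exact setLIntegral_comp_add_le hA.measurableSet hCc.measurableSet
          (fun z hz => ⟨(z, s), ⟨hz, Ioc_subset_Icc_self hs⟩, rfl⟩) (fun z => ‖g z‖ₑ)
    _ < ⊤ := by simpa using hfin

theorem locallyIntegrableOn_comp_add (hΩ : IsOpen Ω) {h : V} (hh : ∀ z ∈ Ω, z + h ∈ Ω)
    {v : V → ℝ} (hv : LocallyIntegrableOn v Ω volume) :
    LocallyIntegrableOn (fun z => v (z + h)) Ω volume := by
  rw [locallyIntegrableOn_iff hΩ.isLocallyClosed]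
  intro A hAΩ hA
  have h1 : IntegrableOn v ((fun z => z + h) '' A) :=
    hv.integrableOn_compact_subset (by rintro _ ⟨z, hz, rfl⟩; exact hh z (hAΩ hz))
      (hA.image (by fun_prop))
  have := (measurePreserving_add_right (volume : Measure V) h).integrableOn_image
    (measurableEmbedding_addRight h) (f := v) (s := A)
  exact this.1 h1

/-- The definition of the weak derivative, tested with the translate `ψ(· - s h)`. -/
theorem integral_weakDeriv_translate {h : V}
    (hh : ∀ z ∈ Ω, ∀ s ∈ Icc (0 : ℝ) 1, z + s • h ∈ Ω) {v g : V → ℝ}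
    (hvg : IsWeakDeriv Ω h v g) {ψ : V → ℝ} (hψ : ContDiff ℝ ∞ ψ) (hc : HasCompactSupport ψ)
    (hs : tsupport ψ ⊆ Ω) {s : ℝ} (hs1 : s ∈ Icc (0 : ℝ) 1) :
    ∫ z, v z * fderiv ℝ ψ (z - s • h) h = - ∫ z, g (z + s • h) * ψ z := by
  set ψs : V → ℝ := fun z => ψ (z - s • h) with hψs
  have h1 : ContDiff ℝ ∞ ψs := by fun_prop
  have hcomp : ψs = ψ ∘ (Homeomorph.subRight (s • h)) := by
    ext z; simp [hψs]
  have h2 : HasCompactSupport ψs := by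
    rw [hcomp]; exact hc.comp_homeomorph _
  have h3 : tsupport ψs ⊆ Ω := by
    rw [hcomp, tsupport_comp_eq_preimage]
    intro z hz
    have := hh _ (hs hz) s hs1
    simpa using this
  have h4 : ∀ z, fderiv ℝ ψs z = fderiv ℝ ψ (z - s • h) := by
    intro z; simp only [hψs, fderiv_comp_sub]
  have key := hvg.2.2 ψs h1 h2 h3
  rw [setIntegral_eq_integral_of_forall_compl_eq_zero,
    setIntegral_eq_integral_of_forall_compl_eq_zero] at key
  · simp_rw [h4] at key
    rw [key]
    congr 1
    rw [← integral_add_right_eq_self (fun z => g z * ψs z) (s • h)]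
    simp [hψs]
  · intro x hx
    rw [image_eq_zero_of_notMem_tsupport (fun h => hx (h3 h)), mul_zero]
  · intro x hx
    have : x ∉ tsupport (fun z => fderiv ℝ ψs z h) :=
      fun h' => hx (h3 (tsupport_fderiv_apply_subset ℝ h h'))
    have h0 : fderiv ℝ ψs x h = 0 :=
      image_eq_zero_of_notMem_tsupport (f := fun z => fderiv ℝ ψs z h) this
    rw [h0, mul_zero]

/-- Integrating the left side of `integral_weakDeriv_translate` over `s ∈ [0, 1]` turns the
derivative of `ψ` into a difference. -/
theorem integral_fderiv_sub_smul {ψ : V → ℝ} (hψ : ContDiff ℝ ∞ ψ) (h z : V) :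
    ∫ s in Ioc (0 : ℝ) 1, fderiv ℝ ψ (z - s • h) h = ψ z - ψ (z - h) := by
  rw [← intervalIntegral.integral_of_le zero_le_one]
  have hd : ∀ s ∈ uIcc (0 : ℝ) 1, HasDerivAt (fun s : ℝ => - ψ (z - s • h))
      (fderiv ℝ ψ (z - s • h) h) s := by
    intro s _
    have h1 : HasFDerivAt ψ (fderiv ℝ ψ (z - s • h)) (z - s • h) :=
      ((hψ.differentiable (by simp)) _).hasFDerivAt
    have h2 : HasDerivAt (fun s : ℝ => z - s • h) (-h) s := by
      have := ((hasDerivAt_id s).smul_const h).const_sub z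
      simpa using this
    have h3 := (h1.comp_hasDerivAt s h2).neg
    rw [map_neg, neg_neg] at h3
    exact h3
  rw [intervalIntegral.integral_eq_sub_of_hasDerivAt hd]
  · simp; ring
  · apply Continuous.intervalIntegrable
    have := continuous_fderiv_apply_const hψ h
    exact this.comp (f := fun s : ℝ => z - s • h) (by fun_prop)

/-- The fundamental theorem of calculus for weak derivatives, along the segments `[z, z + h]`. The
identity is tested with `ψ ∈ C_c^∞(Ω)`; the translates `ψ(· - s h)` are admissible test functions
because `Ω` is stable under translation by `s h`. -/
theorem IsWeakDeriv.ae_translate (hΩ : IsOpen Ω) {h : V}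
    (hh : ∀ z ∈ Ω, ∀ s ∈ Icc (0 : ℝ) 1, z + s • h ∈ Ω) {v g : V → ℝ}
    (hvg : IsWeakDeriv Ω h v g) (hg : Measurable g) :
    ∀ᵐ z ∂(volume.restrict Ω), v (z + h) - v z = ∫ s in Ioc (0 : ℝ) 1, g (z + s • h) := by
  have hh1 : ∀ z ∈ Ω, z + h ∈ Ω := fun z hz => by simpa using hh z hz 1 (by simp)
  have hv1 := locallyIntegrableOn_comp_add hΩ hh1 hvg.1
  have hG : LocallyIntegrableOn (fun z => ∫ s in Ioc (0 : ℝ) 1, g (z + s • h)) Ω volume := by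
    rw [locallyIntegrableOn_iff hΩ.isLocallyClosed]
    intro A hAΩ hA
    exact (integrable_comp_add_smul hh hg hvg.2.1 hA hAΩ).integral_prod_left
  have key := hΩ.ae_eq_zero_of_integral_contDiff_smul_eq_zero (μ := volume)
    ((hv1.sub hvg.1).sub hG) ?_
  · rw [ae_restrict_iff' hΩ.measurableSet]
    filter_upwards [key] with x hx hxΩ
    exact sub_eq_zero.1 (hx hxΩ)
  intro ψ hψ hc hs
  have full : ∀ {f : V → ℝ}, LocallyIntegrableOn f Ω volume →
      Integrable (fun z => f z * ψ z) volume := by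
    intro f hf
    have := integrable_mul_of_tsupport_subset hf hψ.continuous hc hs
    rw [← IntegrableOn, integrableOn_iff_integrable_of_support_subset] at this
    · exact this
    · intro z hz
      by_contra hzΩ
      exact hz (by simp [image_eq_zero_of_notMem_tsupport (fun h => hzΩ (hs h))])
  have split : ∫ z, ψ z • ((fun z => v (z + h)) - v - fun z => ∫ s in Ioc (0 : ℝ) 1, g (z + s • h)) z
      = (∫ z, v (z + h) * ψ z) - (∫ z, v z * ψ z)
        - ∫ z, (∫ s in Ioc (0 : ℝ) 1, g (z + s • h)) * ψ z := by
    have i1 : Integrable (fun z => v (z + h) * ψ z - v z * ψ z) := (full hv1).sub (full hvg.1)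
    have i2 : Integrable (fun z => (∫ s in Ioc (0 : ℝ) 1, g (z + s • h)) * ψ z) := full hG
    rw [← integral_sub (full hv1) (full hvg.1), ← integral_sub i1 i2]
    congr 1; ext z; simp; ring
  rw [split]
  -- Fubini for `g (z + s h) ψ z`.
  have F1 : ∫ z, (∫ s in Ioc (0 : ℝ) 1, g (z + s • h)) * ψ z
      = ∫ s in Ioc (0 : ℝ) 1, ∫ z, g (z + s • h) * ψ z := by
    have e1 : ∀ f : V → ℝ, ∫ z in tsupport ψ, f z * ψ z = ∫ z, f z * ψ z := fun f =>
      setIntegral_eq_integral_of_forall_compl_eq_zero fun z hz => by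
        rw [image_eq_zero_of_notMem_tsupport hz, mul_zero]
    rw [← e1]
    simp_rw [← e1]
    rw [← integral_integral_swap]
    · simp_rw [integral_mul_const]
    · have := integrable_comp_add_smul hh hg hvg.2.1 hc hs
      obtain ⟨M, hM⟩ := hc.exists_bound_of_continuous hψ.continuous
      exact this.mul_bdd (c := M) (hψ.continuous.comp continuous_fst).aestronglyMeasurable
        (ae_of_all _ fun p => hM p.1)
  -- `C` contains the supports of all the translates `ψ(· - s h)`, `0 ≤ s ≤ 1`.
  set C : Set V := (fun p : V × ℝ => p.1 + p.2 • h) '' (tsupport ψ ×ˢ Icc (0 : ℝ) 1) with hC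
  have hCc : IsCompact C := (IsCompact.prod hc isCompact_Icc).image (by fun_prop)
  have hCΩ : C ⊆ Ω := by
    rintro _ ⟨p, hp, rfl⟩
    exact hh p.1 (hs hp.1) p.2 hp.2
  -- Fubini for `v z ∂ₕψ (z - s h)`.
  have F2 : ∫ s in Ioc (0 : ℝ) 1, ∫ z, v z * fderiv ℝ ψ (z - s • h) h
      = ∫ z, v z * (ψ z - ψ (z - h)) := by
    have e1 : ∫ z, v z * (ψ z - ψ (z - h)) = ∫ z in C, v z * (ψ z - ψ (z - h)) := by
      symm
      apply setIntegral_eq_integral_of_forall_compl_eq_zero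
      intro z hz
      have a1 : ψ z = 0 := image_eq_zero_of_notMem_tsupport fun h' =>
        hz ⟨(z, 0), ⟨h', by simp⟩, by simp⟩
      have a2 : ψ (z - h) = 0 := image_eq_zero_of_notMem_tsupport fun h' =>
        hz ⟨(z - h, 1), ⟨h', by simp⟩, by simp⟩
      rw [a1, a2]; simp
    have e2 : ∫ s in Ioc (0 : ℝ) 1, ∫ z, v z * fderiv ℝ ψ (z - s • h) h
        = ∫ s in Ioc (0 : ℝ) 1, ∫ z in C, v z * fderiv ℝ ψ (z - s • h) h := by
      apply setIntegral_congr_fun measurableSet_Ioc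
      intro s hs'
      simp only
      symm
      apply setIntegral_eq_integral_of_forall_compl_eq_zero
      intro z hz
      have : z - s • h ∉ tsupport (fun z => fderiv ℝ ψ z h) := fun h' =>
        hz ⟨(z - s • h, s), ⟨tsupport_fderiv_apply_subset ℝ h h', Ioc_subset_Icc_self hs'⟩, by simp⟩
      have h0 : fderiv ℝ ψ (z - s • h) h = 0 :=
        image_eq_zero_of_notMem_tsupport (f := fun z => fderiv ℝ ψ z h) this
      rw [h0, mul_zero]
    rw [e1, e2, ← integral_integral_swap]
    · simp_rw [integral_const_mul, integral_fderiv_sub_smul hψ]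
    · have hvC : Integrable v (volume.restrict C) := hvg.1.integrableOn_compact_subset hCΩ hCc
      have hd := continuous_fderiv_apply_const hψ h
      obtain ⟨M, hM⟩ := (hasCompactSupport_fderiv_apply hc h).exists_bound_of_continuous hd
      refine (hvC.comp_fst _).mul_bdd (c := M) ?_ (ae_of_all _ fun p => hM (p.1 - p.2 • h))
      exact (hd.comp (f := fun p : V × ℝ => p.1 - p.2 • h) (by fun_prop)).aestronglyMeasurable
  have F3 : ∫ s in Ioc (0 : ℝ) 1, ∫ z, v z * fderiv ℝ ψ (z - s • h) h
      = - ∫ s in Ioc (0 : ℝ) 1, ∫ z, g (z + s • h) * ψ z := by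
    rw [← integral_neg]
    apply setIntegral_congr_fun measurableSet_Ioc
    intro s hs'
    exact integral_weakDeriv_translate hh hvg hψ hc hs (Ioc_subset_Icc_self hs')
  have F4 : ∫ z, v z * (ψ z - ψ (z - h)) = (∫ z, v z * ψ z) - ∫ z, v (z + h) * ψ z := by
    have e1 : (fun z => v (z + h) * ψ z) = fun z => (fun z => v z * ψ (z - h)) (z + h) := by
      ext z; simp
    have i1 : Integrable (fun z => v z * ψ (z - h)) := by
      have := full hv1
      rw [e1] at this
      simpa using this.comp_add_right (-h)
    rw [e1, integral_add_right_eq_self (fun z => v z * ψ (z - h)) h,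
      ← integral_sub (full hvg.1) i1]
    simp_rw [mul_sub]
  rw [F1]
  linarith

/-- The `L²` norm of a difference quotient is controlled by the weak derivative. -/
theorem IsWeakDeriv.lintegral_translate_le (hΩ : IsOpen Ω) {h : V}
    (hh : ∀ z ∈ Ω, ∀ s ∈ Icc (0 : ℝ) 1, z + s • h ∈ Ω) {v g : V → ℝ}
    (hvg : IsWeakDeriv Ω h v g) {A B : Set V} (hA : MeasurableSet A) (hB : MeasurableSet B)
    (hAΩ : A ⊆ Ω) (hBΩ : B ⊆ Ω) (hAB : ∀ z ∈ A, ∀ s ∈ Icc (0 : ℝ) 1, z + s • h ∈ B) :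
    ∫⁻ z in A, ‖v (z + h) - v z‖ₑ ^ 2 ≤ ∫⁻ z in B, ‖g z‖ₑ ^ 2 := by
  obtain ⟨g', hg'm, hg'⟩ := hvg.2.1.aestronglyMeasurable
  have hg'm := hg'm.measurable
  have hvg' := hvg.congr_right hΩ hg'
  have hae := hvg'.ae_translate hΩ hh hg'm
  have hm : Measurable (fun p : V × ℝ => g' (p.1 + p.2 • h)) := by
    apply hg'm.comp
    have : Continuous (fun p : V × ℝ => p.1 + p.2 • h) := by fun_prop
    exact this.measurable
  calc ∫⁻ z in A, ‖v (z + h) - v z‖ₑ ^ 2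
      = ∫⁻ z in A, ‖∫ s in Ioc (0 : ℝ) 1, g' (z + s • h)‖ₑ ^ 2 := by
        apply lintegral_congr_ae
        filter_upwards [ae_mono (Measure.restrict_mono hAΩ le_rfl) hae] with z hz
        rw [hz]
    _ ≤ ∫⁻ z in A, ∫⁻ s in Ioc (0 : ℝ) 1, ‖g' (z + s • h)‖ₑ ^ 2 := by
        apply lintegral_mono
        intro z
        have := enorm_integral_sq_le (μ := volume.restrict (Ioc (0 : ℝ) 1))
          (f := fun s => g' (z + s • h)) (hm.comp measurable_prodMk_left).aestronglyMeasurable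
        simpa using this
    _ = ∫⁻ s in Ioc (0 : ℝ) 1, ∫⁻ z in A, ‖g' (z + s • h)‖ₑ ^ 2 := by
        rw [lintegral_lintegral_swap]
        exact (hm.enorm.pow_const 2).aemeasurable
    _ ≤ ∫⁻ s in Ioc (0 : ℝ) 1, ∫⁻ z in B, ‖g' z‖ₑ ^ 2 := by
        apply setLIntegral_mono' measurableSet_Ioc
        intro s hs
        exact setLIntegral_comp_add_le hA hB (fun z hz => hAB z hz s (Ioc_subset_Icc_self hs))
          (fun z => ‖g' z‖ₑ ^ 2)
    _ = ∫⁻ z in B, ‖g' z‖ₑ ^ 2 := by simp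
    _ = ∫⁻ z in B, ‖g z‖ₑ ^ 2 := by
        apply lintegral_congr_ae
        filter_upwards [ae_mono (Measure.restrict_mono hBΩ le_rfl) hg'] with z hz
        rw [hz]

end Translation

/-! ### The half space and its cylinders -/

section HalfSpace

variable {n : ℕ}

instance : (volume : Measure (Space n × ℝ)).IsAddHaarMeasure :=
  inferInstanceAs (((volume : Measure (Space n)).prod (volume : Measure ℝ)).IsAddHaarMeasure)

theorem isOpen_Q : IsOpen (Q n) := isOpen_univ.prod isOpen_Ioi

theorem measurableSet_Q : MeasurableSet (Q n) := isOpen_Q.measurableSet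

theorem mem_Q {z : Space n × ℝ} : z ∈ Q n ↔ 0 < z.2 := by simp [Q]

theorem measurableSet_Qplus (r : ℝ) : MeasurableSet (Qplus n r) :=
  (Metric.isOpen_ball.prod isOpen_Ioo).measurableSet

theorem Qplus_subset_Q (r : ℝ) : Qplus n r ⊆ Q n := fun _ hz => mem_Q.2 hz.2.1

/-- The cylinders `Q_r⁺` exhaust `Q`, up to its bottom. -/
theorem exists_inter_Q_subset_Qplus {K : Set (Space n × ℝ)} (hK : Bornology.IsBounded K) :
    ∃ r, 0 < r ∧ K ∩ Q n ⊆ Qplus n r := by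
  obtain ⟨R, hR⟩ := hK.exists_norm_le
  refine ⟨|R| + 1, by positivity, fun z hz => ?_⟩
  have h1 := hR z hz.1
  have h2 := (norm_fst_le z).trans h1
  have h3 := (norm_snd_le z).trans h1
  have h4 := le_abs_self R
  have h5 := mem_Q.1 hz.2
  rw [Real.norm_of_nonneg h5.le] at h3
  refine ⟨?_, h5, ?_⟩
  · rw [mem_ball_zero_iff]; linarith
  · nlinarith [abs_nonneg R]

theorem volume_Qplus_lt_top (r : ℝ) : volume (Qplus n r) < ⊤ := by
  have : Bornology.IsBounded (Qplus n r) := Metric.isBounded_ball.prod (Metric.isBounded_Ioo _ _)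
  exact this.measure_lt_top

instance (r : ℝ) : IsFiniteMeasure (volume.restrict (Qplus n r)) :=
  ⟨by simpa using volume_Qplus_lt_top r⟩

/-- `f` is square integrable on every cylinder `Q_r⁺`; the cylinders reach the bottom `{t = 0}`. -/
def MemL2Cyl (f : Space n × ℝ → ℝ) : Prop :=
  ∀ r : ℝ, 0 < r → MemLp f 2 (volume.restrict (Qplus n r))

theorem MemL2Cyl.sub {f g : Space n × ℝ → ℝ} (hf : MemL2Cyl f) (hg : MemL2Cyl g) :
    MemL2Cyl (f - g) := fun r hr => (hf r hr).sub (hg r hr)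

theorem MemL2Cyl.congr {f g : Space n × ℝ → ℝ} (hf : MemL2Cyl f)
    (h : f =ᵐ[volume.restrict (Q n)] g) : MemL2Cyl g := fun r hr =>
  (memLp_congr_ae (ae_mono (Measure.restrict_mono (Qplus_subset_Q r) le_rfl) h)).1 (hf r hr)

theorem MemL2Cyl.locallyIntegrableOn {f : Space n × ℝ → ℝ} (hf : MemL2Cyl f) :
    LocallyIntegrableOn f (Q n) volume := by
  rw [locallyIntegrableOn_iff isOpen_Q.isLocallyClosed]
  intro K hKQ hK
  obtain ⟨r, hr, h⟩ := exists_inter_Q_subset_Qplus hK.isBounded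
  rw [inter_eq_left.2 hKQ] at h
  exact IntegrableOn.mono_set (t := Qplus n r) ((hf r hr).integrable (by norm_num)) h

theorem MemL2Cyl.aestronglyMeasurable {f : Space n × ℝ → ℝ} (hf : MemL2Cyl f) :
    AEStronglyMeasurable f (volume.restrict (Q n)) := hf.locallyIntegrableOn.aestronglyMeasurable

/-- Here `φ` need not vanish on the bottom `{t = 0}`. -/
theorem MemL2Cyl.integrable_mul {f φ : Space n × ℝ → ℝ} (hf : MemL2Cyl f) (hφ : Continuous φ)
    (hc : HasCompactSupport φ) : Integrable (fun z => f z * φ z) (volume.restrict (Q n)) := by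
  obtain ⟨r, hr, h⟩ := exists_inter_Q_subset_Qplus (IsCompact.isBounded hc)
  have h1 : IntegrableOn (fun z => f z * φ z) (Qplus n r) := by
    obtain ⟨M, hM⟩ := hc.exists_bound_of_continuous hφ
    exact ((hf r hr).integrable (by norm_num)).mul_bdd (c := M) hφ.aestronglyMeasurable
      (ae_of_all _ hM)
  refine IntegrableOn.of_forall_sdiff_eq_zero h1 measurableSet_Q fun z hz => ?_
  rw [image_eq_zero_of_notMem_tsupport (fun h' => hz.2 (h ⟨h', hz.1⟩)), mul_zero]

theorem dt_ae_eq {u g : Space n × ℝ → ℝ} (h : IsWeakDeriv (Q n) ((0 : Space n), (1 : ℝ)) u g) :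
    dt u =ᵐ[volume.restrict (Q n)] g :=
  (isWeakDeriv_weakDeriv ⟨g, h⟩).ae_eq isOpen_Q h

theorem dx_ae_eq {i : Fin n} {u g : Space n × ℝ → ℝ}
    (h : IsWeakDeriv (Q n) (basisVec i, (0 : ℝ)) u g) : dx i u =ᵐ[volume.restrict (Q n)] g :=
  (isWeakDeriv_weakDeriv ⟨g, h⟩).ae_eq isOpen_Q h

theorem isWeakDeriv_dt {u : Space n × ℝ → ℝ} (hu : u ∈ USpace n) :
    IsWeakDeriv (Q n) ((0 : Space n), (1 : ℝ)) u (dt u) :=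
  isWeakDeriv_weakDeriv (hu.2.1.imp fun _ h => h.1)

theorem isWeakDeriv_dx {u : Space n × ℝ → ℝ} (hu : u ∈ USpace n) (i : Fin n) :
    IsWeakDeriv (Q n) (basisVec i, (0 : ℝ)) u (dx i u) :=
  isWeakDeriv_weakDeriv ((hu.2.2 i).imp fun _ h => h.1)

theorem memL2Cyl_dt {u : Space n × ℝ → ℝ} (hu : u ∈ USpace n) : MemL2Cyl (dt u) := by
  obtain ⟨g, hg, hg2⟩ := hu.2.1
  exact MemL2Cyl.congr hg2 (dt_ae_eq hg).symm

theorem memL2Cyl_dx {u : Space n × ℝ → ℝ} (hu : u ∈ USpace n) (i : Fin n) :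
    MemL2Cyl (dx i u) := by
  obtain ⟨g, hg, hg2⟩ := hu.2.2 i
  exact MemL2Cyl.congr hg2 (dx_ae_eq hg).symm

/-- The trace condition may be checked with any representative of the weak time derivative. -/
theorem hasInitialTrace_of_ae_eq {u g : Space n × ℝ → ℝ} {u₀ : Space n → ℝ}
    (hg : dt u =ᵐ[volume.restrict (Q n)] g)
    (h : ∀ φ : Space n × ℝ → ℝ, ContDiff ℝ ∞ φ → HasCompactSupport φ →
      ∫ z in Q n, u z * fderiv ℝ φ z ((0 : Space n), (1 : ℝ)) =
        - (∫ z in Q n, g z * φ z) - ∫ x, u₀ x * φ (x, 0)) : HasInitialTrace u u₀ := by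
  intro φ hφ hc
  rw [h φ hφ hc]
  congr 2
  apply integral_congr_ae
  filter_upwards [hg] with z hz
  rw [hz]

end HalfSpace

/-! ### Changes of the time variable -/

section TimeChange

variable {n : ℕ}

/-- A smooth increasing change of the time variable that fixes `0` and delays positive times,
together with its derivative `ρ ≥ 1`. The function `u` is transported to `u ∘ Ψ⁻¹`, where `Ψ (x, s)
= (x, ζ s)`; since `ζ` is a diffeomorphism of `ℝ`, `φ ∘ Ψ` is a test function whenever `φ` is, even
if `φ` does not vanish on `{t = 0}`. -/
structure TimeChange where
  /-- the change of variable -/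
  ζ : ℝ ≃ₜ ℝ
  /-- its derivative -/
  ρ : ℝ → ℝ
  contDiff : ContDiff ℝ ∞ ζ
  hasDerivAt : ∀ s, HasDerivAt ζ (ρ s) s
  one_le : ∀ s, 1 ≤ ρ s
  map_zero : ζ 0 = 0
  le_apply : ∀ s, 0 < s → s ≤ ζ s

namespace TimeChange

variable (T : TimeChange)

theorem pos (s : ℝ) : 0 < T.ρ s := zero_lt_one.trans_le (T.one_le s)

theorem deriv_eq : deriv T.ζ = T.ρ := funext fun s => (T.hasDerivAt s).deriv

theorem contDiff_ρ : ContDiff ℝ ∞ T.ρ := by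
  have := T.contDiff.iterate_deriv 1
  simpa [T.deriv_eq] using this

theorem strictMono : StrictMono T.ζ :=
  strictMono_of_hasDerivAt_pos T.hasDerivAt T.pos

theorem pos_iff (s : ℝ) : 0 < T.ζ s ↔ 0 < s := by
  simpa only [T.map_zero] using T.strictMono.lt_iff_lt (a := 0) (b := s)

/-- The induced change of variables `(x, s) ↦ (x, ζ s)` of space-time. -/
def Ψ (n : ℕ) : Space n × ℝ ≃ₜ Space n × ℝ := (Homeomorph.refl (Space n)).prodCongr T.ζ

theorem Ψ_apply (z : Space n × ℝ) : T.Ψ n z = (z.1, T.ζ z.2) := rfl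

theorem preimage_Q : T.Ψ n ⁻¹' Q n = Q n := by
  ext z
  rw [mem_preimage, mem_Q, mem_Q, T.Ψ_apply, T.pos_iff]

theorem hasFDerivAt_Ψ (z : Space n × ℝ) : HasFDerivAt (T.Ψ n)
    ((ContinuousLinearMap.fst ℝ (Space n) ℝ).prod
      (T.ρ z.2 • ContinuousLinearMap.snd ℝ (Space n) ℝ)) z := by
  have h1 : HasFDerivAt (fun z : Space n × ℝ => T.ζ z.2)
      (T.ρ z.2 • ContinuousLinearMap.snd ℝ (Space n) ℝ) z :=
    (T.hasDerivAt z.2).comp_hasFDerivAt z hasFDerivAt_snd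
  exact hasFDerivAt_fst.prodMk h1

theorem contDiff_Ψ : ContDiff ℝ ∞ (T.Ψ n) :=
  contDiff_fst.prodMk (T.contDiff.comp contDiff_snd)

/-- Change of variables: `ζ` pushes the measure with density `ρ = ζ'` to Lebesgue measure. -/
theorem measurePreserving_ζ : MeasurePreserving T.ζ
    (volume.withDensity fun s => ENNReal.ofReal (T.ρ s)) volume := by
  refine ⟨T.ζ.continuous.measurable, ?_⟩
  have := map_withDensity_abs_det_fderiv_eq_addHaar (volume : Measure ℝ) (s := univ) (f := T.ζ)
    (f' := fun s => ContinuousLinearMap.toSpanSingleton ℝ (T.ρ s)) MeasurableSet.univ.nullMeasurableSet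
    (fun s _ => (T.hasDerivAt s).hasFDerivAt.hasFDerivWithinAt) T.ζ.injective.injOn
  simpa [abs_of_pos (T.pos _), T.ζ.surjective.range_eq] using this

theorem measurePreserving_Ψ : MeasurePreserving (T.Ψ n)
    (volume.withDensity fun z => ENNReal.ofReal (T.ρ z.2)) volume := by
  have h := (MeasurePreserving.id (volume : Measure (Space n))).prod T.measurePreserving_ζ
  rw [prod_withDensity_right] at h
  · exact h
  · exact T.contDiff_ρ.continuous.measurable.ennreal_ofReal

theorem lintegral_Q (F : Space n × ℝ → ℝ≥0∞) :
    ∫⁻ z in Q n, F z = ∫⁻ z in Q n, ENNReal.ofReal (T.ρ z.2) * F (T.Ψ n z) := by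
  have hm : Measurable fun z : Space n × ℝ => ENNReal.ofReal (T.ρ z.2) :=
    (T.contDiff_ρ.continuous.measurable.comp measurable_snd).ennreal_ofReal
  rw [← (T.measurePreserving_Ψ (n := n)).setLIntegral_comp_preimage_emb
    (T.Ψ n).measurableEmbedding F (Q n), T.preimage_Q, restrict_withDensity measurableSet_Q,
    lintegral_withDensity_eq_lintegral_mul_non_measurable _ hm (ae_of_all _ fun _ => by simp)]
  rfl

theorem integral_Q (F : Space n × ℝ → ℝ) :
    ∫ z in Q n, F z = ∫ z in Q n, T.ρ z.2 * F (T.Ψ n z) := by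
  have hm : Measurable fun z : Space n × ℝ => (T.ρ z.2).toNNReal :=
    (T.contDiff_ρ.continuous.measurable.comp measurable_snd).real_toNNReal
  rw [← (T.measurePreserving_Ψ (n := n)).setIntegral_preimage_emb
    (T.Ψ n).measurableEmbedding F (Q n), T.preimage_Q]
  have := setIntegral_withDensity_eq_setIntegral_smul (μ := volume) hm
    (fun z => F (T.Ψ n z)) (measurableSet_Q (n := n))
  refine Eq.trans this ?_
  apply integral_congr_ae
  refine ae_of_all _ fun z => ?_
  simp [NNReal.smul_def, (T.pos z.2).le]

/-- Positive times are delayed, so `Ψ⁻¹` maps each cylinder into itself. -/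
theorem memL2Cyl_comp_symm {f : Space n × ℝ → ℝ} (hf : MemL2Cyl f) :
    MemL2Cyl (f ∘ (T.Ψ n).symm) := by
  intro r hr
  set S := T.Ψ n ⁻¹' Qplus n r with hS
  have hSm : MeasurableSet S := (T.Ψ n).continuous.measurable (measurableSet_Qplus r)
  have hSQ : S ⊆ Qplus n r := by
    intro z hz
    have h1 : 0 < z.2 := (T.pos_iff _).1 hz.2.1
    exact ⟨hz.1, h1, (T.le_apply _ h1).trans_lt hz.2.2⟩
  have hmp : MeasurePreserving (T.Ψ n).symm volume
      (volume.withDensity fun z : Space n × ℝ => ENNReal.ofReal (T.ρ z.2)) :=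
    MeasurePreserving.symm (T.Ψ n).toMeasurableEquiv T.measurePreserving_Ψ
  have hmp2 := hmp.restrict_preimage hSm
  have hpre : (T.Ψ n).symm ⁻¹' S = Qplus n r := by
    ext z; simp [hS]
  rw [hpre] at hmp2
  refine MemLp.comp_measurePreserving ?_ hmp2
  obtain ⟨M, hM⟩ := (isCompact_Icc (a := (0 : ℝ)) (b := r ^ 2)).exists_bound_of_continuousOn
    T.contDiff_ρ.continuous.continuousOn
  have hle : (volume.withDensity fun z : Space n × ℝ => ENNReal.ofReal (T.ρ z.2)).restrict S
      ≤ ENNReal.ofReal M • volume.restrict (Qplus n r) := by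
    rw [restrict_withDensity hSm, ← withDensity_const]
    refine (withDensity_mono (g := fun _ => ENNReal.ofReal M) ?_).trans ?_
    · rw [EventuallyLE, ae_restrict_iff' hSm]
      refine ae_of_all _ fun z hz => ENNReal.ofReal_le_ofReal ?_
      have := hSQ hz
      exact (le_abs_self _).trans (hM z.2 ⟨this.2.1.le, this.2.2.le⟩)
    · rw [withDensity_const, withDensity_const]
      gcongr
  exact ((hf r hr).smul_measure ENNReal.ofReal_ne_top).mono_measure hle

theorem hasCompactSupport_comp {φ : Space n × ℝ → ℝ} (hc : HasCompactSupport φ) :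
    HasCompactSupport (fun z => φ (T.Ψ n z)) := hc.comp_homeomorph (T.Ψ n)

theorem tsupport_comp_subset {φ : Space n × ℝ → ℝ} (hs : tsupport φ ⊆ Q n) :
    tsupport (fun z => φ (T.Ψ n z)) ⊆ Q n := by
  have := tsupport_comp_eq_preimage φ (T.Ψ n)
  rw [Function.comp_def] at this
  rw [this, ← T.preimage_Q]
  exact preimage_mono hs

theorem fderiv_comp {φ : Space n × ℝ → ℝ} (hφ : ContDiff ℝ ∞ φ) (z e : Space n × ℝ) :
    fderiv ℝ (fun z => φ (T.Ψ n z)) z e = fderiv ℝ φ (T.Ψ n z) (e.1, T.ρ z.2 * e.2) := by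
  have h1 : HasFDerivAt φ (fderiv ℝ φ (T.Ψ n z)) (T.Ψ n z) :=
    ((hφ.differentiable (by simp)) _).hasFDerivAt
  have h2 : HasFDerivAt (fun z => φ (T.Ψ n z)) _ z := h1.comp z (T.hasFDerivAt_Ψ z)
  rw [h2.fderiv]
  rfl

/-- The factor `ρ` from the change of variables is absorbed by the time derivative of `φ ∘ Ψ`. -/
theorem integral_comp_symm_mul_fderiv_time (u : Space n × ℝ → ℝ) {φ : Space n × ℝ → ℝ}
    (hφ : ContDiff ℝ ∞ φ) :
    ∫ z in Q n, (u ∘ (T.Ψ n).symm) z * fderiv ℝ φ z ((0 : Space n), (1 : ℝ)) =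
      ∫ z in Q n, u z * fderiv ℝ (fun z => φ (T.Ψ n z)) z ((0 : Space n), (1 : ℝ)) := by
  rw [T.integral_Q]
  congr 1
  ext z
  rw [T.fderiv_comp hφ]
  have : ((0 : Space n), T.ρ z.2 * 1) = T.ρ z.2 • ((0 : Space n), (1 : ℝ)) := by simp
  simp only [this, map_smul, smul_eq_mul, Function.comp_apply, Homeomorph.symm_apply_apply]
  ring

theorem integral_div_comp_symm_mul (g : Space n × ℝ → ℝ) (φ : Space n × ℝ → ℝ) :
    ∫ z in Q n, ((fun z => g z / T.ρ z.2) ∘ (T.Ψ n).symm) z * φ z =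
      ∫ z in Q n, g z * φ (T.Ψ n z) := by
  rw [T.integral_Q]
  congr 1
  ext z
  have := (T.pos z.2).ne'
  simp only [Function.comp_apply, Homeomorph.symm_apply_apply]
  field_simp

theorem memL2Cyl_div {g : Space n × ℝ → ℝ} (hg : MemL2Cyl g) :
    MemL2Cyl (fun z => g z / T.ρ z.2) := by
  intro r hr
  refine (hg r hr).mono ?_ (ae_of_all _ fun z => ?_)
  · simp_rw [div_eq_mul_inv]
    have h1 : Continuous fun z : Space n × ℝ => (T.ρ z.2)⁻¹ :=
      (T.contDiff_ρ.continuous.comp continuous_snd).inv₀ fun z => (T.pos z.2).ne'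
    exact (hg r hr).1.mul h1.aestronglyMeasurable
  · rw [norm_div]
    exact div_le_self (norm_nonneg _) ((T.one_le _).trans (le_abs_self _))

theorem isWeakDeriv_time {u g : Space n × ℝ → ℝ} (hu : MemL2Cyl u) (hg : MemL2Cyl g)
    (h : IsWeakDeriv (Q n) ((0 : Space n), (1 : ℝ)) u g) :
    IsWeakDeriv (Q n) ((0 : Space n), (1 : ℝ)) (u ∘ (T.Ψ n).symm)
      ((fun z => g z / T.ρ z.2) ∘ (T.Ψ n).symm) := by
  refine ⟨(T.memL2Cyl_comp_symm hu).locallyIntegrableOn,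
    (T.memL2Cyl_comp_symm (T.memL2Cyl_div hg)).locallyIntegrableOn, fun φ hφ hc hs => ?_⟩
  rw [T.integral_comp_symm_mul_fderiv_time u hφ, T.integral_div_comp_symm_mul]
  exact h.2.2 _ (hφ.comp T.contDiff_Ψ) (T.hasCompactSupport_comp hc) (T.tsupport_comp_subset hs)

/-- The factor `ρ` depends on time only, so it can be moved into the test function `ρ · (φ ∘ Ψ)`. -/
theorem isWeakDeriv_space {u g : Space n × ℝ → ℝ} (hu : MemL2Cyl u) (hg : MemL2Cyl g)
    {i : Fin n} (h : IsWeakDeriv (Q n) (basisVec i, (0 : ℝ)) u g) :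
    IsWeakDeriv (Q n) (basisVec i, (0 : ℝ)) (u ∘ (T.Ψ n).symm) (g ∘ (T.Ψ n).symm) := by
  refine ⟨(T.memL2Cyl_comp_symm hu).locallyIntegrableOn,
    (T.memL2Cyl_comp_symm hg).locallyIntegrableOn, fun φ hφ hc hs => ?_⟩
  have hρ : ContDiff ℝ ∞ (fun z : Space n × ℝ => T.ρ z.2) := T.contDiff_ρ.comp contDiff_snd
  have hφΨ : ContDiff ℝ ∞ (fun z => φ (T.Ψ n z)) := hφ.comp T.contDiff_Ψ
  have key := h.2.2 (fun z => T.ρ z.2 * φ (T.Ψ n z)) (hρ.mul hφΨ)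
    (T.hasCompactSupport_comp hc).mul_left
    ((tsupport_smul_subset_right (fun z : Space n × ℝ => T.ρ z.2) _).trans (T.tsupport_comp_subset hs))
  have hd : ∀ z, fderiv ℝ (fun z => T.ρ z.2 * φ (T.Ψ n z)) z (basisVec i, (0 : ℝ)) =
      T.ρ z.2 * fderiv ℝ φ (T.Ψ n z) (basisVec i, (0 : ℝ)) := by
    intro z
    have h1 : HasFDerivAt (fun z : Space n × ℝ => T.ρ z.2)
        (deriv T.ρ z.2 • ContinuousLinearMap.snd ℝ (Space n) ℝ) z :=
      ((T.contDiff_ρ.differentiable (by simp)) z.2).hasDerivAt.comp_hasFDerivAt z hasFDerivAt_snd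
    have h2 := ((hφΨ.differentiable (by simp)) z).hasFDerivAt
    have h3 : HasFDerivAt (fun z => T.ρ z.2 * φ (T.Ψ n z)) _ z := h1.mul h2
    rw [h3.fderiv]
    simp [T.fderiv_comp hφ]
  simp_rw [hd] at key
  rw [T.integral_Q (fun z => (u ∘ (T.Ψ n).symm) z * fderiv ℝ φ z (basisVec i, (0 : ℝ))),
    T.integral_Q (fun z => (g ∘ (T.Ψ n).symm) z * φ z)]
  have e1 : ∀ z, T.ρ z.2 * ((u ∘ (T.Ψ n).symm) (T.Ψ n z) *
      fderiv ℝ φ (T.Ψ n z) (basisVec i, (0 : ℝ))) =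
      u z * (T.ρ z.2 * fderiv ℝ φ (T.Ψ n z) (basisVec i, (0 : ℝ))) := by
    intro z; simp; ring
  have e2 : ∀ z, T.ρ z.2 * ((g ∘ (T.Ψ n).symm) (T.Ψ n z) * φ (T.Ψ n z)) =
      g z * (T.ρ z.2 * φ (T.Ψ n z)) := by
    intro z; simp; ring
  rw [integral_congr_ae (ae_of_all _ e1), integral_congr_ae (ae_of_all _ e2)]
  exact key

/-- A change of the time variable gives a competitor with the same initial trace. -/
theorem comp_symm_mem_USpace₀ {u₀ : Space n → ℝ} {u : Space n × ℝ → ℝ} (hu : u ∈ USpace₀ u₀) :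
    u ∘ (T.Ψ n).symm ∈ USpace₀ u₀ := by
  obtain ⟨hU, htr⟩ := hu
  have h1 := T.isWeakDeriv_time hU.1 (memL2Cyl_dt hU) (isWeakDeriv_dt hU)
  refine ⟨⟨T.memL2Cyl_comp_symm hU.1, ⟨_, h1, T.memL2Cyl_comp_symm (T.memL2Cyl_div (memL2Cyl_dt hU))⟩,
    fun i => ⟨_, T.isWeakDeriv_space hU.1 (memL2Cyl_dx hU i) (isWeakDeriv_dx hU i),
      T.memL2Cyl_comp_symm (memL2Cyl_dx hU i)⟩⟩, ?_⟩
  refine hasInitialTrace_of_ae_eq (dt_ae_eq h1) fun φ hφ hc => ?_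
  rw [T.integral_comp_symm_mul_fderiv_time u hφ, T.integral_div_comp_symm_mul,
    htr (fun z => φ (T.Ψ n z)) (hφ.comp T.contDiff_Ψ) (T.hasCompactSupport_comp hc)]
  simp [T.Ψ_apply, T.map_zero]

end TimeChange

end TimeChange

/-! ### The energy as an integral over the half space -/

section Energy

variable {n : ℕ}

theorem restrict_Q : volume.restrict (Q n) =
    (volume : Measure (Space n)).prod (volume.restrict (Ioi (0 : ℝ))) := by
  conv_rhs => rw [← Measure.restrict_univ (μ := (volume : Measure (Space n)))]
  rw [Measure.prod_restrict]
  rfl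

/-- The density `|∇w|² + 2 w₊^γ`, the part of the integrand without the time derivative. -/
noncomputable def staticDensity (γ : ℝ) (w : Space n × ℝ → ℝ) (z : Space n × ℝ) : ℝ≥0∞ :=
  ENNReal.ofReal (∑ i, dx i w z ^ 2) + 2 * ENNReal.ofReal (max (w z) 0 ^ γ)

theorem aemeasurable_dt_sq {w : Space n × ℝ → ℝ} (hw : w ∈ USpace n) :
    AEMeasurable (fun z => dt w z ^ 2) (volume.restrict (Q n)) :=
  (memL2Cyl_dt hw).aestronglyMeasurable.aemeasurable.pow_const 2

theorem aemeasurable_dx_sq {w : Space n × ℝ → ℝ} (hw : w ∈ USpace n) :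
    AEMeasurable (fun z => ∑ i, dx i w z ^ 2) (volume.restrict (Q n)) :=
  Finset.aemeasurable_fun_sum _ fun i _ =>
    (memL2Cyl_dx hw i).aestronglyMeasurable.aemeasurable.pow_const 2

theorem aemeasurable_posPart_rpow {γ : ℝ} {w : Space n × ℝ → ℝ} (hw : w ∈ USpace n) :
    AEMeasurable (fun z => max (w z) 0 ^ γ) (volume.restrict (Q n)) :=
  ((MemL2Cyl.aestronglyMeasurable hw.1).aemeasurable.max aemeasurable_const).pow_const γ

theorem aemeasurable_staticDensity {γ : ℝ} {w : Space n × ℝ → ℝ} (hw : w ∈ USpace n) :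
    AEMeasurable (staticDensity γ w) (volume.restrict (Q n)) :=
  (aemeasurable_dx_sq hw).ennreal_ofReal.add
    ((aemeasurable_posPart_rpow hw).ennreal_ofReal.const_mul 2)

/-- Tonelli's theorem for the energy; the factor `ε` of the kinetic term cancels against the weight.
-/
theorem energy_eq_lintegral {γ ε : ℝ} (hε : 0 < ε) {w : Space n × ℝ → ℝ} (hw : w ∈ USpace n) :
    energy γ ε w = ∫⁻ z in Q n, (ENNReal.ofReal (Real.exp (-z.2 / ε)) * ENNReal.ofReal (dt w z ^ 2)
      + ENNReal.ofReal (Real.exp (-z.2 / ε) / ε) * staticDensity γ w z) := by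
  have hexp : ∀ c : ℝ, AEMeasurable (fun z : Space n × ℝ => ENNReal.ofReal (Real.exp (-z.2 / ε) / c))
      (volume.restrict (Q n)) := fun c => by
    have : Continuous fun z : Space n × ℝ => Real.exp (-z.2 / ε) / c := by fun_prop
    exact this.measurable.ennreal_ofReal.aemeasurable
  have hm1 := (hexp 1).mul (aemeasurable_dt_sq hw).ennreal_ofReal
  have hm2 := (hexp ε).mul (aemeasurable_staticDensity (γ := γ) hw)
  simp only [div_one] at hm1
  have hm : AEMeasurable (fun z => ENNReal.ofReal (Real.exp (-z.2 / ε)) *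
      ENNReal.ofReal (dt w z ^ 2) + ENNReal.ofReal (Real.exp (-z.2 / ε) / ε) *
      staticDensity γ w z) (volume.restrict (Q n)) := hm1.add hm2
  have hmA : AEMeasurable (fun z => ENNReal.ofReal (ε * dt w z ^ 2 + ∑ i, dx i w z ^ 2))
      (volume.restrict (Q n)) :=
    (((aemeasurable_dt_sq hw).const_mul ε).add (aemeasurable_dx_sq hw)).ennreal_ofReal
  rw [restrict_Q] at hm hmA ⊢
  rw [lintegral_prod_symm _ hm]
  unfold energy
  apply lintegral_congr_ae
  have hslice : ∀ᵐ t ∂(volume.restrict (Ioi (0 : ℝ))), AEMeasurable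
      (fun x : Space n => ENNReal.ofReal (ε * dt w (x, t) ^ 2 + ∑ i, dx i w (x, t) ^ 2)) volume := by
    filter_upwards [hmA.aestronglyMeasurable.prodMk_right] with t ht
    exact ht.aemeasurable
  filter_upwards [hslice] with t ht
  rw [← lintegral_const_mul' _ _ (by simp), ← lintegral_add_left' ht,
    ← lintegral_const_mul' _ _ (by simp)]
  congr 1
  ext x
  have e1 : ENNReal.ofReal (ε * dt w (x, t) ^ 2 + ∑ i, dx i w (x, t) ^ 2)
      = ENNReal.ofReal ε * ENNReal.ofReal (dt w (x, t) ^ 2)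
        + ENNReal.ofReal (∑ i, dx i w (x, t) ^ 2) := by
    rw [ENNReal.ofReal_add (by positivity) (Finset.sum_nonneg fun i _ => sq_nonneg _),
      ENNReal.ofReal_mul hε.le]
  have e2 : ENNReal.ofReal (Real.exp (-t / ε)) =
      ENNReal.ofReal (Real.exp (-t / ε) / ε) * ENNReal.ofReal ε := by
    rw [← ENNReal.ofReal_mul (by positivity)]
    congr 1
    field_simp
  rw [e1, e2, staticDensity]
  ring

/-- The energy of the transported function, as an integral in the original time variable. -/
theorem TimeChange.energy_comp_symm (T : TimeChange) {γ ε : ℝ} (hε : 0 < ε)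
    {u₀ : Space n → ℝ} {u : Space n × ℝ → ℝ} (hu : u ∈ USpace₀ u₀) :
    energy γ ε (u ∘ (T.Ψ n).symm) =
      ∫⁻ z in Q n, (ENNReal.ofReal (Real.exp (-T.ζ z.2 / ε) / T.ρ z.2) * ENNReal.ofReal (dt u z ^ 2)
        + ENNReal.ofReal (T.ρ z.2 * Real.exp (-T.ζ z.2 / ε) / ε) * staticDensity γ u z) := by
  have hU := hu.1
  rw [energy_eq_lintegral hε (T.comp_symm_mem_USpace₀ hu).1]
  have h1 := dt_ae_eq (T.isWeakDeriv_time hU.1 (memL2Cyl_dt hU) (isWeakDeriv_dt hU))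
  have h2 : ∀ᵐ z ∂(volume.restrict (Q n)), ∀ i, dx i (u ∘ (T.Ψ n).symm) z
      = (dx i u ∘ (T.Ψ n).symm) z := ae_all_iff.2 fun i =>
    dx_ae_eq (T.isWeakDeriv_space hU.1 (memL2Cyl_dx hU i) (isWeakDeriv_dx hU i))
  have h3 : ∀ᵐ z ∂(volume.restrict (Q n)),
      (ENNReal.ofReal (Real.exp (-z.2 / ε)) * ENNReal.ofReal (dt (u ∘ (T.Ψ n).symm) z ^ 2)
      + ENNReal.ofReal (Real.exp (-z.2 / ε) / ε) * staticDensity γ (u ∘ (T.Ψ n).symm) z) =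
      (ENNReal.ofReal (Real.exp (-z.2 / ε)) *
        ENNReal.ofReal (((fun z => dt u z / T.ρ z.2) ∘ (T.Ψ n).symm) z ^ 2)
      + ENNReal.ofReal (Real.exp (-z.2 / ε) / ε) * (staticDensity γ u ∘ (T.Ψ n).symm) z) := by
    filter_upwards [h1, h2] with z hz1 hz2
    rw [hz1]
    congr 2
    simp only [staticDensity, hz2, Function.comp_apply]
  rw [lintegral_congr_ae h3, T.lintegral_Q]
  congr 1
  ext z
  have hρ := T.pos z.2
  simp only [Function.comp_apply, Homeomorph.symm_apply_apply]
  rw [T.Ψ_apply, mul_add, ← mul_assoc, ← mul_assoc, ← ENNReal.ofReal_mul hρ.le,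
    ← ENNReal.ofReal_mul hρ.le, ← ENNReal.ofReal_mul (by positivity),
    ← ENNReal.ofReal_mul (by positivity)]
  simp only
  congr 1
  · congr 1; field_simp
  · congr 2; ring

end Energy

/-! ### The competitor that is constant in time -/

section ConstantCompetitor

variable {n : ℕ}

theorem memL2Cyl_comp_fst {f : Space n → ℝ} (hf : MemLp f 2 volume) :
    MemL2Cyl (fun z : Space n × ℝ => f z.1) := by
  intro r hr
  have : volume.restrict (Qplus n r) = (volume.restrict (Metric.ball (0 : Space n) r)).prod
      (volume.restrict (Ioo (0 : ℝ) (r ^ 2))) := by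
    rw [Measure.prod_restrict]; rfl
  rw [this]
  exact (hf.restrict _).comp_fst _

theorem hasCompactSupport_slice_space {φ : Space n × ℝ → ℝ} (hc : HasCompactSupport φ) (t : ℝ) :
    HasCompactSupport (fun x => φ (x, t)) := by
  refine HasCompactSupport.intro (hc.image continuous_fst) fun x hx => ?_
  exact image_eq_zero_of_notMem_tsupport fun h => hx ⟨(x, t), h, rfl⟩

theorem hasCompactSupport_slice_time {φ : Space n × ℝ → ℝ} (hc : HasCompactSupport φ)
    (x : Space n) : HasCompactSupport (fun t => φ (x, t)) := by
  refine HasCompactSupport.intro (hc.image continuous_snd) fun t ht => ?_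
  exact image_eq_zero_of_notMem_tsupport fun h => ht ⟨(x, t), h, rfl⟩

theorem hasDerivAt_slice_time {φ : Space n × ℝ → ℝ} (hφ : ContDiff ℝ ∞ φ) (x : Space n) (t : ℝ) :
    HasDerivAt (fun t => φ (x, t)) (fderiv ℝ φ (x, t) ((0 : Space n), (1 : ℝ))) t := by
  have h1 : HasFDerivAt φ (fderiv ℝ φ (x, t)) (x, t) :=
    ((hφ.differentiable (by simp)) _).hasFDerivAt
  have h2 : HasDerivAt (fun t : ℝ => (x, t)) ((0 : Space n), (1 : ℝ)) t :=
    (hasDerivAt_const t x).prodMk (hasDerivAt_id t)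
  exact h1.comp_hasDerivAt t h2

theorem fderiv_slice_space {φ : Space n × ℝ → ℝ} (hφ : ContDiff ℝ ∞ φ) (x e : Space n) (t : ℝ) :
    fderiv ℝ (fun x => φ (x, t)) x e = fderiv ℝ φ (x, t) (e, (0 : ℝ)) := by
  have h1 : HasFDerivAt φ (fderiv ℝ φ (x, t)) (x, t) :=
    ((hφ.differentiable (by simp)) _).hasFDerivAt
  have h2 : HasFDerivAt (fun x : Space n => (x, t))
      ((ContinuousLinearMap.id ℝ (Space n)).prod 0) x :=
    (hasFDerivAt_id x).prodMk (hasFDerivAt_const t x)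
  have h3 : HasFDerivAt (fun x => φ (x, t)) _ x := h1.comp x h2
  rw [h3.fderiv]
  simp

theorem integral_Ioi_fderiv_time {φ : Space n × ℝ → ℝ} (hφ : ContDiff ℝ ∞ φ)
    (hc : HasCompactSupport φ) (x : Space n) :
    ∫ t in Ioi (0 : ℝ), fderiv ℝ φ (x, t) ((0 : Space n), (1 : ℝ)) = - φ (x, 0) := by
  have h1 : ContDiff ℝ ∞ (fun t => φ (x, t)) := hφ.comp (contDiff_const.prodMk contDiff_id)
  rw [← (hasCompactSupport_slice_time hc x).integral_Ioi_deriv_eq (h1.of_le (by simp)) 0]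
  congr 1
  ext t
  rw [(hasDerivAt_slice_time hφ x t).deriv]

theorem integral_Q_comp_fst_mul_fderiv_time {f : Space n → ℝ} (hf : MemLp f 2 volume)
    {φ : Space n × ℝ → ℝ} (hφ : ContDiff ℝ ∞ φ) (hc : HasCompactSupport φ) :
    ∫ z in Q n, f z.1 * fderiv ℝ φ z ((0 : Space n), (1 : ℝ)) = - ∫ x, f x * φ (x, 0) := by
  have hi := (memL2Cyl_comp_fst hf).integrable_mul
    (continuous_fderiv_apply_const hφ ((0 : Space n), (1 : ℝ)))
    (hasCompactSupport_fderiv_apply hc _)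
  rw [restrict_Q] at hi ⊢
  rw [integral_prod _ hi, ← integral_neg]
  congr 1
  ext x
  simp only
  rw [integral_const_mul, integral_Ioi_fderiv_time hφ hc]
  ring

theorem isWeakDeriv_time_comp_fst {f : Space n → ℝ} (hf : MemLp f 2 volume) :
    IsWeakDeriv (Q n) ((0 : Space n), (1 : ℝ)) (fun z => f z.1) 0 := by
  refine ⟨(memL2Cyl_comp_fst hf).locallyIntegrableOn, locallyIntegrableOn_zero,
    fun φ hφ hc hs => ?_⟩
  rw [integral_Q_comp_fst_mul_fderiv_time hf hφ hc]
  have : ∀ x : Space n, φ (x, 0) = 0 := fun x =>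
    image_eq_zero_of_notMem_tsupport fun h => by simpa [mem_Q] using hs h
  simp [this]

theorem isWeakDeriv_space_comp_fst {f g : Space n → ℝ} (hf : MemLp f 2 volume)
    (hg : MemLp g 2 volume) {i : Fin n} (h : IsWeakDeriv univ (basisVec i) f g) :
    IsWeakDeriv (Q n) (basisVec i, (0 : ℝ)) (fun z => f z.1) (fun z => g z.1) := by
  refine ⟨(memL2Cyl_comp_fst hf).locallyIntegrableOn, (memL2Cyl_comp_fst hg).locallyIntegrableOn,
    fun φ hφ hc hs => ?_⟩
  have hi1 := (memL2Cyl_comp_fst hf).integrable_mul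
    (continuous_fderiv_apply_const hφ (basisVec i, (0 : ℝ))) (hasCompactSupport_fderiv_apply hc _)
  have hi2 := (memL2Cyl_comp_fst hg).integrable_mul hφ.continuous hc
  rw [restrict_Q] at hi1 hi2 ⊢
  rw [integral_prod_symm _ hi1, integral_prod_symm _ hi2, ← integral_neg]
  congr 1
  ext t
  have h1 : ContDiff ℝ ∞ (fun x => φ (x, t)) := hφ.comp (contDiff_id.prodMk contDiff_const)
  have := h.2.2 (fun x => φ (x, t)) h1 (hasCompactSupport_slice_space hc t) (subset_univ _)
  simpa [fderiv_slice_space hφ] using this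

/-- The function that is constant in time, equal to the initial datum, is a competitor. Its energy,
the static energy of the datum, does not depend on `ε`. -/
theorem exists_energy_bound {γ : ℝ} (hγ : 1 ≤ γ) {u₀ : Space n → ℝ} (hu₀ : MemH1 u₀)
    (hu₀γ : MemLp u₀ (ENNReal.ofReal γ) volume) :
    (fun z : Space n × ℝ => u₀ z.1) ∈ USpace₀ u₀ ∧
    ∃ C : ℝ≥0∞, C ≠ ⊤ ∧ ∀ ε : ℝ, 0 < ε → energy γ ε (fun z : Space n × ℝ => u₀ z.1) ≤ C := by
  choose g hg hg2 using hu₀.2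
  have ht := isWeakDeriv_time_comp_fst hu₀.1
  have hx := fun i => isWeakDeriv_space_comp_fst hu₀.1 (hg2 i) (hg i)
  have hmem : (fun z : Space n × ℝ => u₀ z.1) ∈ USpace₀ u₀ := by
    refine ⟨⟨memL2Cyl_comp_fst hu₀.1, ⟨0, ht, fun r hr => MemLp.zero⟩,
      fun i => ⟨_, hx i, memL2Cyl_comp_fst (hg2 i)⟩⟩, ?_⟩
    refine hasInitialTrace_of_ae_eq (dt_ae_eq ht) fun φ hφ hc => ?_
    rw [integral_Q_comp_fst_mul_fderiv_time hu₀.1 hφ hc]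
    simp
  refine ⟨hmem, ∫⁻ x, (ENNReal.ofReal (∑ i, g i x ^ 2) + 2 * ENNReal.ofReal (max (u₀ x) 0 ^ γ)),
    ?_, ?_⟩
  · have hm : AEMeasurable (fun x => ENNReal.ofReal (∑ i, g i x ^ 2)) volume :=
      (Finset.aemeasurable_fun_sum _ fun i _ => (hg2 i).1.aemeasurable.pow_const 2).ennreal_ofReal
    rw [lintegral_add_left' hm, lintegral_const_mul' _ _ (by simp)]
    refine ENNReal.add_ne_top.2 ⟨?_, ENNReal.mul_ne_top (by simp) ?_⟩
    · have : Integrable (fun x => ∑ i, g i x ^ 2) volume :=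
        integrable_finsetSum _ fun i _ => (hg2 i).integrable_sq
      exact (this.lintegral_lt_top).ne
    · have h0 : γ ≠ 0 := by linarith
      have hfin := lintegral_rpow_enorm_lt_top_of_eLpNorm_lt_top
        (by simp; linarith) (by simp) hu₀γ.2
      rw [ENNReal.toReal_ofReal (by linarith)] at hfin
      refine ((lintegral_mono fun x => ?_).trans_lt hfin).ne
      rw [← ofReal_norm, ENNReal.ofReal_rpow_of_nonneg (norm_nonneg _) (by linarith)]
      apply ENNReal.ofReal_le_ofReal
      apply Real.rpow_le_rpow (le_max_right _ _) _ (by linarith)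
      exact max_le (le_abs_self _) (norm_nonneg _)
  · intro ε hε
    rw [energy_eq_lintegral hε hmem.1]
    have hxall : ∀ᵐ z ∂(volume.restrict (Q n)), ∀ i,
        dx i (fun z : Space n × ℝ => u₀ z.1) z = g i z.1 :=
      ae_all_iff.2 fun i => dx_ae_eq (hx i)
    have hmF : AEMeasurable (fun x : Space n => ENNReal.ofReal (∑ i, g i x ^ 2) +
        2 * ENNReal.ofReal (max (u₀ x) 0 ^ γ)) volume :=
      (Finset.aemeasurable_fun_sum _ fun i _ =>
        (hg2 i).1.aemeasurable.pow_const 2).ennreal_ofReal.add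
      (((hu₀.1.1.aemeasurable.max aemeasurable_const).pow_const γ).ennreal_ofReal.const_mul 2)
    have hme : Measurable fun t : ℝ => ENNReal.ofReal (Real.exp (-t / ε) / ε) := by
      have : Continuous fun t : ℝ => Real.exp (-t / ε) / ε := by fun_prop
      exact this.measurable.ennreal_ofReal
    have hone : ∫⁻ t in Ioi (0 : ℝ), ENNReal.ofReal (Real.exp (-t / ε) / ε) = 1 := by
      have e1 : ∀ t : ℝ, -t / ε = (-ε⁻¹) * t := fun t => by field_simp
      simp_rw [e1]
      rw [← ofReal_integral_eq_lintegral_ofReal]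
      · rw [integral_div, integral_exp_mul_Ioi (by simpa using hε)]
        have : ε ≠ 0 := hε.ne'
        simp [this]
      · exact (integrableOn_exp_mul_Ioi (by simpa using hε) 0).div_const ε
      · exact ae_of_all _ fun t => by positivity
    calc _ = ∫⁻ z in Q n, (fun x => ENNReal.ofReal (∑ i, g i x ^ 2) +
          2 * ENNReal.ofReal (max (u₀ x) 0 ^ γ)) z.1 *
          (fun t => ENNReal.ofReal (Real.exp (-t / ε) / ε)) z.2 := by
          apply lintegral_congr_ae
          filter_upwards [hxall, dt_ae_eq ht] with z hz1 hz2
          simp only [hz2, staticDensity, hz1, Pi.zero_apply]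
          simp [mul_comm]
      _ ≤ _ := by
          rw [restrict_Q, lintegral_prod_mul hmF hme.aemeasurable, hone, mul_one]

end ConstantCompetitor

/-! ### A delay of time -/

section Delay

/-- The time change `ζ(s) = s + l ε (e^{s/ε} - 2 + e^{s/ε - s})`. The displacement vanishes at `s =
0`, has the sign of `s`, and grows so fast that the weight `e^{-ζ(s)/ε}` decays super-exponentially.
-/
noncomputable def delayFun (ε l : ℝ) (s : ℝ) : ℝ :=
  s + l * (ε * (Real.exp (s / ε) - 2 + Real.exp (s / ε - s)))

/-- The derivative of `delayFun`. -/
noncomputable def delayDeriv (ε l : ℝ) (s : ℝ) : ℝ :=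
  1 + l * (Real.exp (s / ε) + (1 - ε) * Real.exp (s / ε - s))

theorem contDiff_delayFun (ε l : ℝ) : ContDiff ℝ ∞ (delayFun ε l) := by
  unfold delayFun
  fun_prop

theorem hasDerivAt_delayFun {ε : ℝ} (hε : 0 < ε) (l s : ℝ) :
    HasDerivAt (delayFun ε l) (delayDeriv ε l s) s := by
  have h0 : HasDerivAt (fun s : ℝ => s / ε) (1 / ε) s := (hasDerivAt_id s).div_const ε
  have h1 : HasDerivAt (fun s : ℝ => Real.exp (s / ε)) (Real.exp (s / ε) * (1 / ε)) s := h0.exp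
  have h2 : HasDerivAt (fun s : ℝ => Real.exp (s / ε - s)) (Real.exp (s / ε - s) * (1 / ε - 1)) s :=
    (h0.sub (hasDerivAt_id s)).exp
  have h3 : HasDerivAt (delayFun ε l) (1 + l * (ε * (Real.exp (s / ε) * (1 / ε) +
      Real.exp (s / ε - s) * (1 / ε - 1)))) s :=
    (hasDerivAt_id s).add (((h1.sub_const 2).add h2).const_mul ε |>.const_mul l)
  convert h3 using 1
  rw [delayDeriv]
  field_simp

theorem one_le_delayDeriv {ε l : ℝ} (hε1 : ε < 1) (hl : 0 ≤ l) (s : ℝ) :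
    1 ≤ delayDeriv ε l s := by
  unfold delayDeriv
  have : 0 ≤ 1 - ε := by linarith
  have : 0 ≤ l * (Real.exp (s / ε) + (1 - ε) * Real.exp (s / ε - s)) := by positivity
  linarith

theorem le_div_self_of_lt_one {ε s : ℝ} (hε : 0 < ε) (hε1 : ε < 1) (hs : 0 ≤ s) : s ≤ s / ε := by
  rw [le_div_iff₀ hε]; nlinarith

theorem le_delayFun {ε l : ℝ} (hε : 0 < ε) (hε1 : ε < 1) (hl : 0 ≤ l) {s : ℝ} (hs : 0 ≤ s) :
    s ≤ delayFun ε l s := by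
  unfold delayFun
  have h1 : 1 ≤ Real.exp (s / ε) := Real.one_le_exp (by positivity)
  have h2 : 1 ≤ Real.exp (s / ε - s) :=
    Real.one_le_exp (by linarith [le_div_self_of_lt_one hε hε1 hs])
  have : 0 ≤ l * (ε * (Real.exp (s / ε) - 2 + Real.exp (s / ε - s))) :=
    mul_nonneg hl (mul_nonneg hε.le (by linarith))
  linarith

theorem delayFun_le {ε l : ℝ} (hε : 0 < ε) (hε1 : ε < 1) (hl : 0 ≤ l) {s : ℝ} (hs : s ≤ 0) :
    delayFun ε l s ≤ s := by
  unfold delayFun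
  have h0 : s / ε ≤ s := by rw [div_le_iff₀ hε]; nlinarith
  have h1 : Real.exp (s / ε) ≤ 1 := Real.exp_le_one_iff.2 (by linarith)
  have h2 : Real.exp (s / ε - s) ≤ 1 := Real.exp_le_one_iff.2 (by linarith)
  have : 0 ≤ l * (ε * (2 - Real.exp (s / ε) - Real.exp (s / ε - s))) :=
    mul_nonneg hl (mul_nonneg hε.le (by linarith))
  linarith

/-- `delayFun` as a `TimeChange`. -/
noncomputable def delay {ε l : ℝ} (hε : 0 < ε) (hε1 : ε < 1) (hl : 0 ≤ l) : TimeChange where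
  ζ := (StrictMono.orderIsoOfSurjective (delayFun ε l)
    (strictMono_of_hasDerivAt_pos (hasDerivAt_delayFun hε l)
      fun s => zero_lt_one.trans_le (one_le_delayDeriv hε1 hl s))
    ((contDiff_delayFun ε l).continuous.surjective
      (tendsto_atTop_mono' atTop ((eventually_ge_atTop 0).mono fun _ h => le_delayFun hε hε1 hl h)
        tendsto_id)
      (tendsto_atBot_mono' atBot ((eventually_le_atBot 0).mono fun _ h => delayFun_le hε hε1 hl h)
        tendsto_id))).toHomeomorph
  ρ := delayDeriv ε l
  contDiff := contDiff_delayFun ε l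
  hasDerivAt := hasDerivAt_delayFun hε l
  one_le := one_le_delayDeriv hε1 hl
  map_zero := by
    change delayFun ε l 0 = 0
    simp [delayFun]; norm_num
  le_apply := fun _ hs => le_delayFun hε hε1 hl hs.le

theorem exp_neg_delayFun_div {ε l : ℝ} (hε : 0 < ε) (s : ℝ) :
    Real.exp (-delayFun ε l s / ε) =
      Real.exp (-s / ε) * Real.exp (-(l * (Real.exp (s / ε) - 2 + Real.exp (s / ε - s)))) := by
  rw [← Real.exp_add]
  congr 1
  unfold delayFun
  field_simp
  ring

/-- The weight of `|∂ₜu|²` in the energy of the delayed copy is at most `1 + 4 l` times the weight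
`e^{-s/ε}` in the energy of `u`, with the gain `(l / 2) e^{-s}` on the interval where
`l e^{s/ε} ≤ 1/4`. -/
theorem delay_kinetic_weight_le {ε l : ℝ} (hε : 0 < ε) (hε1 : ε < 1) (hl : 0 ≤ l) {s : ℝ}
    (hs : 0 < s) : Real.exp (-delayFun ε l s / ε) / delayDeriv ε l s
      + (if l * Real.exp (s / ε) ≤ 1 / 4 then l / 2 * Real.exp (-s) else 0) ≤
      (1 + 4 * l) * Real.exp (-s / ε) := by
  have hρ := one_le_delayDeriv hε1 hl s
  rw [exp_neg_delayFun_div hε]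
  set y := Real.exp (s / ε) with hy
  have hyi : Real.exp (-s / ε) = y⁻¹ := by rw [hy, ← Real.exp_neg, neg_div]
  have hy1 : 1 ≤ y := Real.one_le_exp (by positivity)
  have h2 : 1 ≤ Real.exp (s / ε - s) :=
    Real.one_le_exp (by linarith [le_div_self_of_lt_one hε hε1 hs.le])
  have hG : Real.exp (-(l * (y - 2 + Real.exp (s / ε - s)))) ≤ 1 :=
    Real.exp_le_one_iff.2 (by nlinarith)
  have hρ2 : 1 + l * y ≤ delayDeriv ε l s := by
    unfold delayDeriv
    have : 0 ≤ l * ((1 - ε) * Real.exp (s / ε - s)) :=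
      mul_nonneg hl (mul_nonneg (by linarith) (by positivity))
    rw [← hy]; linarith
  have hly : 0 ≤ l * y := by positivity
  rw [hyi]
  have h3 : y⁻¹ * Real.exp (-(l * (y - 2 + Real.exp (s / ε - s)))) / delayDeriv ε l s ≤
      y⁻¹ / (1 + l * y) :=
    div_le_div₀ (by positivity) (mul_le_of_le_one_right (by positivity) hG) (by positivity) hρ2
  have h4 : y⁻¹ / (1 + l * y) = y⁻¹ - l / (1 + l * y) := by
    field_simp; ring
  have h6 : 0 ≤ 4 * l * y⁻¹ := by positivity
  split_ifs with h
  · have h5 : l / 2 ≤ l / (1 + l * y) := div_le_div_of_nonneg_left hl (by positivity) (by linarith)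
    have h7 : l / 2 * Real.exp (-s) ≤ l / 2 :=
      mul_le_of_le_one_right (by positivity) (Real.exp_le_one_iff.2 (by linarith))
    linarith
  · have h5 : 0 ≤ l / (1 + l * y) := by positivity
    linarith

/-- The weight of the static density in the energy of the delayed copy is at most `1 + 4 l` times
the weight `e^{-s/ε} / ε` in the energy of `u`, with the same gain as for the kinetic term. The
inequality `1 + x ≤ e^x` for the derivative of the time change leaves the exponent `2 l - l ε e^{s/ε
- s}`. -/
theorem delay_static_weight_le {ε l : ℝ} (hε : 0 < ε) (hε1 : ε < 1) (hl : 0 ≤ l)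
    (hl4 : l ≤ 1 / 4) {s : ℝ} (hs : 0 < s) :
    delayDeriv ε l s * Real.exp (-delayFun ε l s / ε) / ε
      + (if l * Real.exp (s / ε) ≤ 1 / 4 then l / 2 * Real.exp (-s) else 0) ≤
      (1 + 4 * l) * (Real.exp (-s / ε) / ε) := by
  rw [exp_neg_delayFun_div hε]
  set y := Real.exp (s / ε) with hy
  have hyi : Real.exp (-s / ε) = y⁻¹ := by rw [hy, ← Real.exp_neg, neg_div]
  have hy0 : 0 < y := Real.exp_pos _
  set m := Real.exp (-s) with hm
  have hm0 : 0 < m := Real.exp_pos _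
  have hm1 : m ≤ 1 := Real.exp_le_one_iff.2 (by linarith)
  have hym : Real.exp (s / ε - s) = y * m := by rw [hy, hm, ← Real.exp_add]; rfl
  set x := l * ε * y * m with hx
  have hx0 : 0 ≤ x := by positivity
  have hρ : delayDeriv ε l s ≤ Real.exp (l * (y + (1 - ε) * (y * m))) := by
    unfold delayDeriv
    rw [← hy, hym, add_comm]
    exact Real.add_one_le_exp _
  -- From `1 - 2 l ≤ e^{-2l}`, using `l ≤ 1/4`.
  have h2l : Real.exp (2 * l) ≤ 1 + 4 * l := by
    have h1 := Real.one_sub_le_exp_neg (2 * l)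
    rw [Real.exp_neg] at h1
    have h2 := Real.exp_pos (2 * l)
    have h3 : (1 - 2 * l) * Real.exp (2 * l) ≤ 1 := by
      calc (1 - 2 * l) * Real.exp (2 * l) ≤ (Real.exp (2 * l))⁻¹ * Real.exp (2 * l) := by gcongr
        _ = 1 := inv_mul_cancel₀ h2.ne'
    nlinarith
  have hprod : delayDeriv ε l s * Real.exp (-(l * (y - 2 + y * m))) ≤
      Real.exp (2 * l) * Real.exp (-x) := by
    calc _ ≤ Real.exp (l * (y + (1 - ε) * (y * m))) * Real.exp (-(l * (y - 2 + y * m))) := by gcongr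
      _ = Real.exp (2 * l + -x) := by rw [← Real.exp_add]; congr 1; rw [hx]; ring
      _ = _ := Real.exp_add _ _
  rw [hyi, hym]
  have h1 : delayDeriv ε l s * (y⁻¹ * Real.exp (-(l * (y - 2 + y * m)))) / ε ≤
      y⁻¹ * (Real.exp (2 * l) * Real.exp (-x)) / ε := by
    have : delayDeriv ε l s * (y⁻¹ * Real.exp (-(l * (y - 2 + y * m)))) =
      y⁻¹ * (delayDeriv ε l s * Real.exp (-(l * (y - 2 + y * m)))) := by ring
    rw [this]
    gcongr
  refine (add_le_add_left h1 _).trans ?_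
  have hone : 1 ≤ Real.exp (2 * l) := Real.one_le_exp (by positivity)
  split_ifs with h
  · have hx1 : x ≤ 1 := by
      have : x = (l * y) * (ε * m) := by rw [hx]; ring
      have h3 : ε * m ≤ 1 := by nlinarith
      rw [this]
      have h4 : 0 ≤ l * y := by positivity
      nlinarith
    -- `e^{-x} ≤ 1 / (1 + x) ≤ 1 - x / 2` for `0 ≤ x ≤ 1`.
    have he : Real.exp (-x) ≤ 1 - x / 2 := by
      have h1 := Real.add_one_le_exp x
      rw [Real.exp_neg]
      rw [inv_le_comm₀ (Real.exp_pos _) (by linarith)]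
      refine le_trans ?_ h1
      rw [inv_le_iff_one_le_mul₀ (by linarith)]
      nlinarith
    have hxe : y⁻¹ * (x / 2) / ε = l / 2 * m := by
      rw [hx]; field_simp
    have h5 : y⁻¹ * (Real.exp (2 * l) * Real.exp (-x)) / ε ≤ y⁻¹ * ((1 + 4 * l) - x / 2) / ε := by
      gcongr
      calc Real.exp (2 * l) * Real.exp (-x) ≤ Real.exp (2 * l) * (1 - x / 2) := by gcongr
        _ ≤ (1 + 4 * l) - x / 2 := by nlinarith
    have h6 : y⁻¹ * ((1 + 4 * l) - x / 2) / ε = (1 + 4 * l) * (y⁻¹ / ε) - y⁻¹ * (x / 2) / ε := by ring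
    linarith
  · rw [add_zero]
    have he : Real.exp (-x) ≤ 1 := Real.exp_le_one_iff.2 (by linarith)
    calc y⁻¹ * (Real.exp (2 * l) * Real.exp (-x)) / ε ≤ y⁻¹ * ((1 + 4 * l) * 1) / ε := by gcongr
      _ = (1 + 4 * l) * (y⁻¹ / ε) := by ring

end Delay

/-! ### The energy estimate, uniform in `ε` -/

section UniformEstimate

variable {n : ℕ}

/-- The time slab `ℝⁿ × (0, S)`. -/
def slab (n : ℕ) (S : ℝ) : Set (Space n × ℝ) := univ ×ˢ Ioo 0 S

theorem mem_slab {S : ℝ} {z : Space n × ℝ} : z ∈ slab n S ↔ 0 < z.2 ∧ z.2 < S := by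
  simp [slab]

theorem measurableSet_slab (S : ℝ) : MeasurableSet (slab n S) :=
  MeasurableSet.univ.prod measurableSet_Ioo

theorem slab_subset_Q (S : ℝ) : slab n S ⊆ Q n := fun _ hz => mem_Q.2 (mem_slab.1 hz).1

/-- The energy estimate, uniform in `ε`: if `B` is the integral on the left, the weighted inequality
for the delayed copy `w` reads `𝓔(w) + (l / 2) e^{-S} B ≤ (1 + 4 l) 𝓔(u)`, and `𝓔(u) ≤ 𝓔(w)`. -/
theorem IsMinimizer.lintegral_slab_le {γ ε : ℝ} (hε : ε ∈ Ioo (0 : ℝ) 1) {u₀ : Space n → ℝ}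
    {u : Space n × ℝ → ℝ} (hu : IsMinimizer γ ε u₀ u) {C : ℝ≥0∞} (hC : C ≠ ⊤)
    (hE : energy γ ε u ≤ C) {S : ℝ} (hS : 0 < S) :
    ∫⁻ z in slab n S, (ENNReal.ofReal (dt u z ^ 2) + staticDensity γ u z) ≤
      ENNReal.ofReal (Real.exp S) * (8 * C) := by
  -- The size of the delay is chosen so that `l e^{s/ε} ≤ 1/4` exactly for `s ≤ S`.
  set l : ℝ := Real.exp (-S / ε) / 4 with hl
  have hε0 := hε.1
  have hl0 : 0 < l := by positivity
  have hl4 : l ≤ 1 / 4 := by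
    have : Real.exp (-S / ε) ≤ 1 :=
      Real.exp_le_one_iff.2 (div_nonpos_of_nonpos_of_nonneg (by linarith) hε0.le)
    rw [hl]; linarith
  have hlS : ∀ s, s < S → l * Real.exp (s / ε) ≤ 1 / 4 := by
    intro s hs
    have h1 : Real.exp (-S / ε) * Real.exp (s / ε) ≤ 1 := by
      rw [← Real.exp_add]
      refine Real.exp_le_one_iff.2 ?_
      rw [← add_div]
      exact div_nonpos_of_nonpos_of_nonneg (by linarith) hε0.le
    rw [hl]; linarith
  set T := delay hε0 hε.2 hl0.le with hT
  have hw := T.comp_symm_mem_USpace₀ (n := n) hu.1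
  have hmin := hu.2 _ hw
  have hUe := energy_eq_lintegral (γ := γ) hε0 hu.1.1
  have hWe := T.energy_comp_symm (γ := γ) hε0 hu.1
  set B := fun z => ENNReal.ofReal (dt u z ^ 2) + staticDensity γ u z with hB
  have hBm : AEMeasurable B (volume.restrict (Q n)) :=
    (aemeasurable_dt_sq hu.1.1).ennreal_ofReal.add (aemeasurable_staticDensity hu.1.1)
  have hm : AEMeasurable ((slab n S).indicator
      fun z => ENNReal.ofReal (l / 2 * Real.exp (-z.2)) * B z) (volume.restrict (Q n)) := by
    refine AEMeasurable.indicator (AEMeasurable.mul ?_ hBm) (measurableSet_slab S)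
    have : Continuous fun z : Space n × ℝ => l / 2 * Real.exp (-z.2) := by fun_prop
    exact this.measurable.ennreal_ofReal.aemeasurable
  have key : energy γ ε (u ∘ (T.Ψ n).symm) +
      ∫⁻ z in Q n, (slab n S).indicator (fun z => ENNReal.ofReal (l / 2 * Real.exp (-z.2)) * B z) z
      ≤ ENNReal.ofReal (1 + 4 * l) * energy γ ε u := by
    rw [hUe, hWe, ← lintegral_const_mul' _ _ (by simp), ← lintegral_add_right' _ hm]
    apply setLIntegral_mono' measurableSet_Q
    intro z hz
    have hz0 := mem_Q.1 hz
    have k1 := delay_kinetic_weight_le hε0 hε.2 hl0.le hz0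
    have k2 := delay_static_weight_le hε0 hε.2 hl0.le hl4 hz0
    set c : ℝ := if l * Real.exp (z.2 / ε) ≤ 1 / 4 then l / 2 * Real.exp (-z.2) else 0 with hc
    have hc0 : 0 ≤ c := by rw [hc]; split_ifs <;> positivity
    have hind : (slab n S).indicator (fun z => ENNReal.ofReal (l / 2 * Real.exp (-z.2)) * B z) z
        ≤ ENNReal.ofReal c * B z := by
      by_cases h : z ∈ slab n S
      · rw [indicator_of_mem h, hc, if_pos (hlS _ (mem_slab.1 h).2)]
      · rw [indicator_of_notMem h]; exact zero_le
    refine (add_le_add_right hind _).trans ?_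
    have hρ : 0 < T.ρ z.2 := T.pos z.2
    have k1' : ENNReal.ofReal (Real.exp (-T.ζ z.2 / ε) / T.ρ z.2) + ENNReal.ofReal c ≤
        ENNReal.ofReal (1 + 4 * l) * ENNReal.ofReal (Real.exp (-z.2 / ε)) := by
      rw [← ENNReal.ofReal_add (by positivity) hc0, ← ENNReal.ofReal_mul (by positivity)]
      exact ENNReal.ofReal_le_ofReal k1
    have k2' : ENNReal.ofReal (T.ρ z.2 * Real.exp (-T.ζ z.2 / ε) / ε) + ENNReal.ofReal c ≤
        ENNReal.ofReal (1 + 4 * l) * ENNReal.ofReal (Real.exp (-z.2 / ε) / ε) := by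
      rw [← ENNReal.ofReal_add (by positivity) hc0, ← ENNReal.ofReal_mul (by positivity)]
      exact ENNReal.ofReal_le_ofReal k2
    calc _ = (ENNReal.ofReal (Real.exp (-T.ζ z.2 / ε) / T.ρ z.2) + ENNReal.ofReal c) *
            ENNReal.ofReal (dt u z ^ 2) +
          (ENNReal.ofReal (T.ρ z.2 * Real.exp (-T.ζ z.2 / ε) / ε) + ENNReal.ofReal c) *
            staticDensity γ u z := by simp only [hB]; ring
      _ ≤ (ENNReal.ofReal (1 + 4 * l) * ENNReal.ofReal (Real.exp (-z.2 / ε))) *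
            ENNReal.ofReal (dt u z ^ 2) +
          (ENNReal.ofReal (1 + 4 * l) * ENNReal.ofReal (Real.exp (-z.2 / ε) / ε)) *
            staticDensity γ u z := by gcongr
      _ = _ := by ring
  have hEu : energy γ ε u ≠ ⊤ := (hE.trans_lt hC.lt_top).ne
  rw [lintegral_indicator (measurableSet_slab S), Measure.restrict_restrict (measurableSet_slab S),
    inter_eq_left.2 (slab_subset_Q S)] at key
  have key2 : ∫⁻ z in slab n S, ENNReal.ofReal (l / 2 * Real.exp (-z.2)) * B z ≤
      ENNReal.ofReal (4 * l) * energy γ ε u := by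
    have h1 := (add_le_add_left hmin _).trans key
    rw [ENNReal.ofReal_add zero_le_one (by positivity), ENNReal.ofReal_one, add_mul, one_mul] at h1
    exact (ENNReal.add_le_add_iff_left hEu).1 h1
  have hlow : ENNReal.ofReal (l / 2 * Real.exp (-S)) * ∫⁻ z in slab n S, B z ≤
      ∫⁻ z in slab n S, ENNReal.ofReal (l / 2 * Real.exp (-z.2)) * B z := by
    rw [← lintegral_const_mul' _ _ (by simp)]
    apply setLIntegral_mono' (measurableSet_slab S)
    intro z hz
    gcongr
    exact (mem_slab.1 hz).2.le
  have hfin := (hlow.trans key2).trans (mul_le_mul_right hE _)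
  have hsplit : ENNReal.ofReal (4 * l) * C = ENNReal.ofReal (l / 2 * Real.exp (-S)) *
      (ENNReal.ofReal (Real.exp S) * (8 * C)) := by
    have h8 : (8 : ℝ≥0∞) = ENNReal.ofReal 8 := by simp
    rw [h8, ← mul_assoc, ← mul_assoc, ← ENNReal.ofReal_mul (by positivity),
      ← ENNReal.ofReal_mul (by positivity)]
    congr 2
    have : Real.exp (-S) * Real.exp S = 1 := by rw [← Real.exp_add]; simp
    linear_combination (-4 * l) * this
  rw [hsplit] at hfin
  exact (ENNReal.mul_le_mul_iff_right (by simpa using by positivity) (by simp)).1 hfin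

end UniformEstimate

/-! ### Weak sequential compactness in `L²` -/

section WeakCompactness

/-- A finite family of sequences that are bounded in `L²` has a common subsequence along which all
of them converge weakly. -/
theorem exists_subseq_tendsto_weak_L2 {α ι : Type*} [MeasurableSpace α]
    [MeasurableSpace.CountablyGenerated α] [Fintype ι] {μ : Measure α} [SFinite μ]
    {F : ℕ → ι → α → ℝ} (hF : ∀ j k, MemLp (F j k) 2 μ) {M : ℝ≥0∞} (hM : M ≠ ⊤)
    (hFM : ∀ j k, eLpNorm (F j k) 2 μ ≤ M) :
    ∃ (a : ℕ → ℕ) (G : ι → α → ℝ), StrictMono a ∧ (∀ k, MemLp (G k) 2 μ) ∧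
      ∀ k g, MemLp g 2 μ →
        Tendsto (fun j => ∫ x, F (a j) k x * g x ∂μ) atTop (𝓝 (∫ x, G k x * g x ∂μ)) := by
  classical
  have : Fact ((2 : ℝ≥0∞) ≠ ⊤) := ⟨by simp⟩
  have inner_eq : ∀ f g : Lp ℝ 2 μ, inner ℝ f g = ∫ x, f x * g x ∂μ := fun f g => by
    rw [L2.inner_def]
    congr 1
    ext x
    simp [mul_comm]
  set f : ℕ → ι → Lp ℝ 2 μ := fun j k => (hF j k).toLp (F j k) with hf
  -- The whole family is one bounded sequence in the dual of the separable space `ι → L²`.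
  set Φ : ℕ → StrongDual ℝ (ι → Lp ℝ 2 μ) := fun j =>
    ∑ k, (innerSL ℝ (f j k)).comp (ContinuousLinearMap.proj k) with hΦ
  have hΦa : ∀ j g, Φ j g = ∑ k, inner ℝ (f j k) (g k) := fun j g => by
    simp [hΦ]
  have hnorm : ∀ j, ‖Φ j‖ ≤ ∑ _k : ι, M.toReal := by
    intro j
    refine ContinuousLinearMap.opNorm_le_bound _ (by positivity) fun g => ?_
    rw [hΦa, Finset.sum_mul]
    refine (norm_sum_le _ _).trans (Finset.sum_le_sum fun k _ => ?_)
    refine (norm_inner_le_norm _ _).trans ?_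
    gcongr
    · rw [hf, Lp.norm_toLp]
      exact ENNReal.toReal_mono hM (hFM j k)
    · exact norm_le_pi_norm g k
  obtain ⟨Ψ, -, a, ha, hlim⟩ := WeakDual.isSeqCompact_closedBall ℝ (ι → Lp ℝ 2 μ) 0
    (∑ _k : ι, M.toReal) (x := fun j => StrongDual.toWeakDual (Φ j))
    (fun j => by
      simp only [mem_preimage, Metric.mem_closedBall, dist_zero_right]
      exact hnorm j)
  have heval : ∀ g : ι → Lp ℝ 2 μ, Tendsto (fun j => Φ (a j) g) atTop (𝓝 (Ψ g)) := fun g =>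
    ((WeakDual.eval_continuous g).tendsto Ψ).comp hlim
  let Λ : ι → StrongDual ℝ (Lp ℝ 2 μ) := fun k =>
    (WeakDual.toStrongDual Ψ).comp (ContinuousLinearMap.single ℝ (fun _ : ι => Lp ℝ 2 μ) k)
  refine ⟨a, fun k => ((InnerProductSpace.toDual ℝ (Lp ℝ 2 μ)).symm (Λ k) : Lp ℝ 2 μ), ha,
    fun k => Lp.memLp _, fun k g hg => ?_⟩
  have h1 := heval (Pi.single k (hg.toLp g))
  have h2 : Ψ (Pi.single k (hg.toLp g)) =
      inner ℝ ((InnerProductSpace.toDual ℝ (Lp ℝ 2 μ)).symm (Λ k)) (hg.toLp g) := by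
    rw [InnerProductSpace.toDual_symm_apply]
    rfl
  have h3 : ∀ j, Φ (a j) (Pi.single k (hg.toLp g)) = inner ℝ (f (a j) k) (hg.toLp g) := by
    intro j
    rw [hΦa, Finset.sum_eq_single k]
    · simp
    · intro b _ hb
      simp [Pi.single_eq_of_ne hb]
    · simp
  rw [h2] at h1
  simp_rw [h3, inner_eq] at h1
  have e1 : ∀ j, ∫ x, f (a j) k x * hg.toLp g x ∂μ = ∫ x, F (a j) k x * g x ∂μ := fun j => by
    apply integral_congr_ae
    filter_upwards [(hF (a j) k).coeFn_toLp, hg.coeFn_toLp] with x hx1 hx2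
    rw [hx1, hx2]
  have e2 : ∫ x, ((InnerProductSpace.toDual ℝ (Lp ℝ 2 μ)).symm (Λ k) : Lp ℝ 2 μ) x *
      hg.toLp g x ∂μ = ∫ x, ((InnerProductSpace.toDual ℝ (Lp ℝ 2 μ)).symm (Λ k) : Lp ℝ 2 μ) x *
      g x ∂μ := by
    apply integral_congr_ae
    filter_upwards [hg.coeFn_toLp] with x hx2
    rw [hx2]
  simp_rw [e1] at h1
  rwa [e2] at h1

end WeakCompactness

/-! ### From slab bounds to weighted bounds -/

section WeightedBound

variable {n : ℕ}

theorem lintegral_Ioi_mul_exp_neg {a : ℝ} (ha : 0 < a) (c : ℝ) :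
    ∫⁻ T in Ioi c, ENNReal.ofReal (a * Real.exp (-a * T)) = ENNReal.ofReal (Real.exp (-a * c)) := by
  rw [← ofReal_integral_eq_lintegral_ofReal]
  · rw [integral_const_mul, integral_exp_mul_Ioi (by linarith)]
    congr 1
    field_simp
  · exact (integrableOn_exp_mul_Ioi (by linarith) c).const_mul a
  · exact ae_of_all _ fun t => by positivity

/-- Exponentially growing bounds on the slabs `{0 < t < T}` give a bound on the half space with an
exponentially decaying weight, because `e^{-4t} = ∫_t^∞ 4 e^{-4T} dT`. -/
theorem lintegral_Q_exp_neg_mul_le {f : Space n × ℝ → ℝ≥0∞}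
    (hf : AEMeasurable f (volume.restrict (Q n))) {M : ℝ≥0∞}
    (h : ∀ T, 0 < T → ∫⁻ z in slab n T, f z ≤ M * ENNReal.ofReal (Real.exp (2 * T))) :
    ∫⁻ z in Q n, ENNReal.ofReal (Real.exp (-4 * z.2)) * f z ≤ 2 * M := by
  set k : ℝ → ℝ≥0∞ := fun T => ENNReal.ofReal (4 * Real.exp (-4 * T)) with hk
  have hkm : Measurable k := by
    have : Continuous fun T : ℝ => 4 * Real.exp (-4 * T) := by fun_prop
    exact this.measurable.ennreal_ofReal
  have hset : MeasurableSet {p : (Space n × ℝ) × ℝ | p.1.2 < p.2} :=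
    measurableSet_lt (by fun_prop) (by fun_prop)
  calc ∫⁻ z in Q n, ENNReal.ofReal (Real.exp (-4 * z.2)) * f z
      = ∫⁻ z in Q n, ∫⁻ T in Ioi (0 : ℝ),
          {p : (Space n × ℝ) × ℝ | p.1.2 < p.2}.indicator (fun p => k p.2 * f p.1) (z, T) := by
        apply setLIntegral_congr_fun measurableSet_Q
        intro z hz
        have hz0 := mem_Q.1 hz
        have e1 : ∀ T : ℝ, {p : (Space n × ℝ) × ℝ | p.1.2 < p.2}.indicator
            (fun p => k p.2 * f p.1) (z, T) = (Ioi z.2).indicator (fun T => k T * f z) T := by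
          intro T; simp [indicator]
        simp_rw [e1]
        rw [lintegral_indicator measurableSet_Ioi, Measure.restrict_restrict measurableSet_Ioi,
          inter_eq_left.2 (Ioi_subset_Ioi hz0.le), lintegral_mul_const _ hkm,
          lintegral_Ioi_mul_exp_neg (by norm_num)]
    _ = ∫⁻ T in Ioi (0 : ℝ), ∫⁻ z in Q n,
          {p : (Space n × ℝ) × ℝ | p.1.2 < p.2}.indicator (fun p => k p.2 * f p.1) (z, T) := by
        rw [lintegral_lintegral_swap]
        refine AEMeasurable.indicator ?_ hset
        exact (hkm.comp measurable_snd).aemeasurable.mul hf.comp_fst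
    _ ≤ ∫⁻ T in Ioi (0 : ℝ), M * 2 * ENNReal.ofReal (2 * Real.exp (-2 * T)) := by
        apply setLIntegral_mono' measurableSet_Ioi
        intro T hT
        have e1 : ∀ z : Space n × ℝ, {p : (Space n × ℝ) × ℝ | p.1.2 < p.2}.indicator
            (fun p => k p.2 * f p.1) (z, T) = {z : Space n × ℝ | z.2 < T}.indicator
              (fun z => k T * f z) z := by
          intro z; simp [indicator]
        simp_rw [e1]
        have hsT : MeasurableSet {z : Space n × ℝ | z.2 < T} :=
          measurableSet_lt (by fun_prop) (by fun_prop)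
        have hsl : {z : Space n × ℝ | z.2 < T} ∩ Q n = slab n T := by
          ext z; simp [mem_slab, mem_Q, and_comm]
        rw [lintegral_indicator hsT, Measure.restrict_restrict hsT, hsl,
          lintegral_const_mul' _ _ ENNReal.ofReal_ne_top]
        refine (mul_le_mul_right (h T hT) _).trans (le_of_eq ?_)
        have e2 : k T * ENNReal.ofReal (Real.exp (2 * T)) =
            2 * ENNReal.ofReal (2 * Real.exp (-2 * T)) := by
          rw [hk, ← ENNReal.ofReal_mul (by positivity), mul_assoc, ← Real.exp_add]
          have : (2 : ℝ≥0∞) = ENNReal.ofReal 2 := by simp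
          rw [this, ← ENNReal.ofReal_mul (by norm_num)]
          congr 1
          ring_nf
        calc k T * (M * ENNReal.ofReal (Real.exp (2 * T)))
            = M * (k T * ENNReal.ofReal (Real.exp (2 * T))) := by ring
          _ = _ := by rw [e2]; ring
    _ ≤ 2 * M := by
        have hm2 : Measurable fun T : ℝ => ENNReal.ofReal (2 * Real.exp (-2 * T)) := by
          have : Continuous fun T : ℝ => 2 * Real.exp (-2 * T) := by fun_prop
          exact this.measurable.ennreal_ofReal
        rw [lintegral_const_mul _ hm2, lintegral_Ioi_mul_exp_neg (by norm_num)]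
        simp [mul_comm]

end WeightedBound

/-! ### Control of `u` by its trace and its time derivative -/

section InitialDatum

variable {n : ℕ}

/-- The extension of `u` from the half space `Q` by its initial datum, constant in time. -/
noncomputable def extendByDatum (u : Space n × ℝ → ℝ) (u₀ : Space n → ℝ) : Space n × ℝ → ℝ :=
  (Q n).indicator u + (Q n)ᶜ.indicator (fun z => u₀ z.1)

theorem integral_Iic_fderiv_time {φ : Space n × ℝ → ℝ} (hφ : ContDiff ℝ ∞ φ)
    (hc : HasCompactSupport φ) (x : Space n) :
    ∫ t in Iic (0 : ℝ), fderiv ℝ φ (x, t) ((0 : Space n), (1 : ℝ)) = φ (x, 0) := by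
  have h1 : ContDiff ℝ ∞ (fun t => φ (x, t)) := hφ.comp (contDiff_const.prodMk contDiff_id)
  rw [← (hasCompactSupport_slice_time hc x).integral_Iic_deriv_eq (h1.of_le (by simp)) 0]
  congr 1
  ext t
  rw [(hasDerivAt_slice_time hφ x t).deriv]

theorem locallyIntegrable_comp_fst {f : Space n → ℝ} (hf : MemLp f 2 volume) :
    LocallyIntegrableOn (fun z : Space n × ℝ => f z.1) univ volume := by
  rw [locallyIntegrableOn_iff isClosed_univ.isLocallyClosed]
  intro K _ hK
  have hsub : K ⊆ (Prod.fst '' K) ×ˢ (Prod.snd '' K) := fun z hz => ⟨⟨z, hz, rfl⟩, ⟨z, hz, rfl⟩⟩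
  have h1 : IsCompact (Prod.fst '' K) := hK.image continuous_fst
  have h2 : IsCompact (Prod.snd '' K) := hK.image continuous_snd
  refine IntegrableOn.mono_set ?_ hsub
  have hi : IntegrableOn f (Prod.fst '' K) := by
    have : IsFiniteMeasure (volume.restrict (Prod.fst '' K)) :=
      ⟨by simpa using h1.measure_lt_top⟩
    exact (hf.restrict _).integrable (by norm_num)
  have : IsFiniteMeasure (volume.restrict (Prod.snd '' K)) := ⟨by simpa using h2.measure_lt_top⟩
  have := hi.comp_fst (volume.restrict (Prod.snd '' K))
  rw [Measure.prod_restrict] at this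
  exact this

/-- In terms of the extension, the trace condition says that the weak time derivative on the whole
space has no singular part on `{t = 0}`. -/
theorem isWeakDeriv_extendByDatum {u₀ : Space n → ℝ} (hu₀ : MemLp u₀ 2 volume)
    {u : Space n × ℝ → ℝ} (hu : u ∈ USpace₀ u₀) :
    IsWeakDeriv univ ((0 : Space n), (1 : ℝ)) (extendByDatum u u₀) ((Q n).indicator (dt u)) := by
  have hQ : MeasurableSet (Q n) := measurableSet_Q
  have hLI : ∀ f : Space n × ℝ → ℝ, MemL2Cyl f →
      LocallyIntegrableOn ((Q n).indicator f) univ volume := by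
    intro f hf
    rw [locallyIntegrableOn_iff isClosed_univ.isLocallyClosed]
    intro K _ hK
    obtain ⟨r, hr, h⟩ := exists_inter_Q_subset_Qplus hK.isBounded
    rw [IntegrableOn, integrable_indicator_iff hQ, IntegrableOn, Measure.restrict_restrict hQ,
      inter_comm]
    exact IntegrableOn.mono_set (t := Qplus n r) ((hf r hr).integrable (by norm_num)) h
  have hsplit : extendByDatum u u₀ =
      (Q n).indicator u + (Q n)ᶜ.indicator (fun z : Space n × ℝ => u₀ z.1) := rfl
  have hi2 : LocallyIntegrableOn ((Q n)ᶜ.indicator (fun z : Space n × ℝ => u₀ z.1)) univ volume := by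
    have h0 := locallyIntegrable_comp_fst hu₀
    rw [locallyIntegrableOn_iff isClosed_univ.isLocallyClosed] at h0 ⊢
    exact fun K hK hKc => (h0 K hK hKc).indicator hQ.compl
  have hLIu : LocallyIntegrableOn (extendByDatum u u₀) univ volume := by
    rw [hsplit]
    exact (hLI u hu.1.1).add hi2
  refine ⟨hLIu, hLI _ (memL2Cyl_dt hu.1), fun φ hφ hc hs => ?_⟩
  have hd := continuous_fderiv_apply_const hφ ((0 : Space n), (1 : ℝ))
  have hdc := hasCompactSupport_fderiv_apply hc ((0 : Space n), (1 : ℝ))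
  have hint := integrable_mul_of_tsupport_subset hLIu hd hdc (subset_univ _)
  rw [Measure.restrict_univ] at hint ⊢
  rw [← integral_add_compl hQ hint]
  have e1 : ∫ z in Q n, extendByDatum u u₀ z * fderiv ℝ φ z ((0 : Space n), (1 : ℝ)) =
      ∫ z in Q n, u z * fderiv ℝ φ z ((0 : Space n), (1 : ℝ)) :=
    setIntegral_congr_fun hQ fun z hz => by simp [extendByDatum, hz]
  have e2 : ∫ z in (Q n)ᶜ, extendByDatum u u₀ z * fderiv ℝ φ z ((0 : Space n), (1 : ℝ)) =
      ∫ z in (Q n)ᶜ, u₀ z.1 * fderiv ℝ φ z ((0 : Space n), (1 : ℝ)) :=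
    setIntegral_congr_fun hQ.compl fun z hz => by
      have : z ∉ Q n := hz
      simp [extendByDatum, this]
  have e3 : ∫ z in (Q n)ᶜ, u₀ z.1 * fderiv ℝ φ z ((0 : Space n), (1 : ℝ)) =
      ∫ x, u₀ x * φ (x, 0) := by
    have hi := integrable_mul_of_tsupport_subset (locallyIntegrable_comp_fst hu₀) hd hdc
      (subset_univ _)
    have hi := hi.mono_measure (Measure.restrict_mono (subset_univ (Q n)ᶜ) le_rfl)
    have hres : volume.restrict (Q n)ᶜ =
        (volume : Measure (Space n)).prod (volume.restrict (Iic (0 : ℝ))) := by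
      conv_rhs => rw [← Measure.restrict_univ (μ := (volume : Measure (Space n)))]
      rw [Measure.prod_restrict]
      congr 1
      ext z; simp [mem_Q]
    rw [hres] at hi ⊢
    rw [integral_prod _ hi]
    congr 1
    ext x
    simp only
    rw [integral_const_mul, integral_Iic_fderiv_time hφ hc]
  have e4 : ∫ z, (Q n).indicator (dt u) z * φ z = ∫ z in Q n, dt u z * φ z := by
    rw [← integral_indicator hQ]
    congr 1
    ext z
    by_cases hz : z ∈ Q n <;> simp [hz]
  rw [e1, e2, e3, e4, hu.2 φ hφ hc]
  ring

/-- Translation by `-T` takes `(x, t)` with `0 < t < T` to a point where the extension is `u₀ x`. -/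
theorem lintegral_slab_sub_datum_le {u₀ : Space n → ℝ} (hu₀ : MemLp u₀ 2 volume)
    {u : Space n × ℝ → ℝ} (hu : u ∈ USpace₀ u₀) {T : ℝ} (hT : 0 < T) :
    ∫⁻ z in slab n T, ‖u₀ z.1 - u z‖ₑ ^ 2 ≤
      ENNReal.ofReal (T ^ 2) * ∫⁻ z in slab n T, ENNReal.ofReal (dt u z ^ 2) := by
  have hw := (isWeakDeriv_extendByDatum hu₀ hu).smul_dir (-T)
  set B : Set (Space n × ℝ) := {z | z.2 < T} with hB
  have hBm : MeasurableSet B := measurableSet_lt (by fun_prop) (by fun_prop)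
  have key := hw.lintegral_translate_le isOpen_univ (by simp) (measurableSet_slab T) hBm
    (subset_univ _) (subset_univ _) (fun z hz s hs => by
      have := mem_slab.1 hz
      simp only [hB, mem_ofPred_eq, Prod.snd_add, Prod.smul_snd, smul_eq_mul]
      nlinarith [hs.1])
  have e1 : ∫⁻ z in slab n T, ‖u₀ z.1 - u z‖ₑ ^ 2 = ∫⁻ z in slab n T,
      ‖extendByDatum u u₀ (z + (-T) • ((0 : Space n), (1 : ℝ))) - extendByDatum u u₀ z‖ₑ ^ 2 := by
    apply setLIntegral_congr_fun (measurableSet_slab T)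
    intro z hz
    have hz' := mem_slab.1 hz
    have h1 : z ∈ Q n := slab_subset_Q T hz
    have h2 : z + (-T) • ((0 : Space n), (1 : ℝ)) ∉ Q n := by
      simp [mem_Q]; linarith
    simp only [extendByDatum, Pi.add_apply, indicator_of_mem h1, indicator_of_notMem h2,
      indicator_of_mem (mem_compl h2), indicator_of_notMem (notMem_compl_iff.2 h1)]
    simp
  rw [e1]
  refine key.trans (le_of_eq ?_)
  rw [← lintegral_const_mul' _ _ (by simp)]
  have e2 : ∀ z, ‖-T * (Q n).indicator (dt u) z‖ₑ ^ 2 =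
      (Q n).indicator (fun z => ENNReal.ofReal (T ^ 2) * ENNReal.ofReal (dt u z ^ 2)) z := by
    intro z
    by_cases hz : z ∈ Q n
    · rw [indicator_of_mem hz, indicator_of_mem hz, ← ENNReal.ofReal_mul (by positivity),
        ← ofReal_norm, ← ENNReal.ofReal_pow (norm_nonneg _)]
      congr 1
      rw [Real.norm_eq_abs, sq_abs]; ring
    · simp [hz]
  simp_rw [e2]
  rw [lintegral_indicator measurableSet_Q, Measure.restrict_restrict measurableSet_Q]
  congr 2
  ext z; simp [mem_slab, mem_Q, hB]

theorem lintegral_slab_sq_le {u₀ : Space n → ℝ} (hu₀ : MemLp u₀ 2 volume)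
    {u : Space n × ℝ → ℝ} (hu : u ∈ USpace₀ u₀) {T : ℝ} (hT : 0 < T) :
    ∫⁻ z in slab n T, ‖u z‖ₑ ^ 2 ≤ 2 * (ENNReal.ofReal T * ∫⁻ x, ‖u₀ x‖ₑ ^ 2) +
      2 * (ENNReal.ofReal (T ^ 2) * ∫⁻ z in slab n T, ENNReal.ofReal (dt u z ^ 2)) := by
  have hres : volume.restrict (slab n T) =
      (volume : Measure (Space n)).prod (volume.restrict (Ioo (0 : ℝ) T)) := by
    conv_rhs => rw [← Measure.restrict_univ (μ := (volume : Measure (Space n)))]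
    rw [Measure.prod_restrict]
    rfl
  have hm : AEMeasurable (fun x => ‖u₀ x‖ₑ ^ 2) volume := hu₀.1.enorm.pow_const 2
  have e0 : ∫⁻ z in slab n T, ‖u₀ z.1‖ₑ ^ 2 = ENNReal.ofReal T * ∫⁻ x, ‖u₀ x‖ₑ ^ 2 := by
    have := lintegral_prod_mul (ν := volume.restrict (Ioo (0 : ℝ) T)) hm
      (aemeasurable_const (b := (1 : ℝ≥0∞)))
    rw [hres]
    simpa [mul_comm] using this
  have hm0 : AEMeasurable (fun z : Space n × ℝ => 2 * ‖u₀ z.1‖ₑ ^ 2) (volume.restrict (slab n T)) := by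
    rw [hres]
    exact hm.comp_fst.const_mul 2
  calc ∫⁻ z in slab n T, ‖u z‖ₑ ^ 2
      ≤ ∫⁻ z in slab n T, (2 * ‖u₀ z.1‖ₑ ^ 2 + 2 * ‖u₀ z.1 - u z‖ₑ ^ 2) := by
        apply lintegral_mono
        intro z
        have := enorm_add_sq_le (u₀ z.1) (-(u₀ z.1 - u z))
        rw [enorm_neg] at this
        simpa using this
    _ = 2 * (∫⁻ z in slab n T, ‖u₀ z.1‖ₑ ^ 2) + 2 * ∫⁻ z in slab n T, ‖u₀ z.1 - u z‖ₑ ^ 2 := by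
        rw [lintegral_add_left' hm0, lintegral_const_mul' _ _ (by simp),
          lintegral_const_mul' _ _ (by simp)]
    _ ≤ _ := by
        rw [e0]
        gcongr
        exact lintegral_slab_sub_datum_le hu₀ hu hT

end InitialDatum

/-! ### Local strong convergence -/

section StrongConvergence

open scoped Pointwise

variable {n : ℕ}

/-- The coordinates of a displacement in space-time. -/
theorem sum_smul_basisVec (h : Space n × ℝ) :
    (∑ i, h.1 i • ((basisVec i : Space n), (0 : ℝ))) + h.2 • ((0 : Space n), (1 : ℝ)) = h := by
  classical
  have h1 : ∑ i, h.1 i • (basisVec i : Space n) = h.1 := by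
    ext j
    simp [basisVec, Finset.sum_apply, Pi.single_apply]
  refine Prod.ext ?_ ?_
  · simp [Prod.fst_sum, h1]
  · simp [Prod.snd_sum]

/-- The weak derivative in an arbitrary direction, from the partial derivatives. -/
theorem isWeakDeriv_dir {f g₀ : Space n × ℝ → ℝ} {g : Fin n → Space n × ℝ → ℝ}
    (h₀ : IsWeakDeriv (Q n) ((0 : Space n), (1 : ℝ)) f g₀)
    (hg : ∀ i, IsWeakDeriv (Q n) (basisVec i, (0 : ℝ)) f (g i)) (h : Space n × ℝ) :
    IsWeakDeriv (Q n) h f (fun z => (∑ i, h.1 i * g i z) + h.2 * g₀ z) := by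
  have h1 := (IsWeakDeriv.sum_dir Finset.univ h₀.1 fun i => (hg i).smul_dir (h.1 i)).add_dir
    (h₀.smul_dir h.2)
  rw [sum_smul_basisVec] at h1
  convert h1 using 1
  ext z
  simp [Finset.sum_apply]

theorem sq_dir_le {δ : ℝ} {h : Space n × ℝ} (h1 : ‖h.1‖ ≤ δ) (h2 : |h.2| ≤ δ) (a : Fin n → ℝ)
    (b : ℝ) : ((∑ i, h.1 i * a i) + h.2 * b) ^ 2 ≤ 2 * δ ^ 2 * (b ^ 2 + ∑ i, a i ^ 2) := by
  have e1 : (∑ i, h.1 i * a i) ^ 2 ≤ (∑ i, h.1 i ^ 2) * ∑ i, a i ^ 2 :=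
    Finset.sum_mul_sq_le_sq_mul_sq _ _ _
  have e2 : ∑ i, h.1 i ^ 2 ≤ δ ^ 2 := by
    have := EuclideanSpace.norm_sq_eq h.1
    simp only [Real.norm_eq_abs, sq_abs] at this
    rw [← this]
    gcongr
  have e3 : h.2 ^ 2 ≤ δ ^ 2 := sq_le_sq' (by linarith [(abs_le.1 h2).1]) (abs_le.1 h2).2
  have e4 : 0 ≤ ∑ i, a i ^ 2 := Finset.sum_nonneg fun i _ => sq_nonneg _
  have e5 : (∑ i, h.1 i ^ 2) * ∑ i, a i ^ 2 ≤ δ ^ 2 * ∑ i, a i ^ 2 := by gcongr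
  have e6 : (h.2 * b) ^ 2 ≤ δ ^ 2 * b ^ 2 := by rw [mul_pow]; gcongr
  nlinarith [sq_nonneg ((∑ i, h.1 i * a i) - h.2 * b)]

/-- The displacements of size at most `δ` that do not decrease time, used for averaging: translation
by them maps `Q` into itself. -/
def upBall (n : ℕ) (δ : ℝ) : Set (Space n × ℝ) := Metric.closedBall 0 δ ×ˢ Icc 0 δ

theorem mem_upBall {δ : ℝ} {h : Space n × ℝ} : h ∈ upBall n δ ↔ ‖h.1‖ ≤ δ ∧ 0 ≤ h.2 ∧ h.2 ≤ δ := by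
  simp [upBall]

theorem isCompact_upBall (δ : ℝ) : IsCompact (upBall n δ) :=
  (isCompact_closedBall _ _).prod isCompact_Icc

theorem volume_upBall_pos {δ : ℝ} (hδ : 0 < δ) : 0 < volume (upBall n δ) := by
  have h1 : (Metric.ball (0 : Space n) δ ×ˢ Ioo 0 δ) ⊆ upBall n δ :=
    prod_mono Metric.ball_subset_closedBall Ioo_subset_Icc_self
  refine lt_of_lt_of_le ?_ (measure_mono h1)
  refine (Metric.isOpen_ball.prod isOpen_Ioo).measure_pos _ ?_
  exact ⟨(0, δ / 2), by simp [hδ], by simp [hδ]⟩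

/-- All small nonnegative-time translates of a compact subset of `Q` stay in one cylinder. -/
theorem exists_Qplus_translates {K : Set (Space n × ℝ)} (hK : IsCompact K) (hKQ : K ⊆ Q n) :
    ∃ r, 0 < r ∧ ∀ δ ≤ 1, ∀ z ∈ K, ∀ h ∈ upBall n δ, ∀ s ∈ Icc (0 : ℝ) 1, z + s • h ∈ Qplus n r := by
  obtain ⟨r, hr, hsub⟩ := exists_inter_Q_subset_Qplus
    (hK.add (isCompact_closedBall (0 : Space n × ℝ) 1)).isBounded
  refine ⟨r, hr, fun δ hδ z hz h hh s hs => hsub ⟨?_, ?_⟩⟩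
  · refine add_mem_add hz ?_
    rw [mem_closedBall_zero_iff, norm_smul, Real.norm_of_nonneg hs.1]
    have := mem_upBall.1 hh
    have h1 : ‖h‖ ≤ 1 := by
      rw [Prod.norm_def, Real.norm_of_nonneg this.2.1]
      exact max_le (by linarith) (by linarith)
    nlinarith [hs.1, hs.2, norm_nonneg h]
  · have h1 := mem_Q.1 (hKQ hz)
    have h2 := (mem_upBall.1 hh).2.1
    rw [mem_Q]
    simp only [Prod.snd_add, Prod.smul_snd, smul_eq_mul]
    have := mul_nonneg hs.1 h2
    linarith

/-- Difference quotients in the directions of `upBall` are controlled by the gradient. -/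
theorem lintegral_translate_sub_le {f g₀ : Space n × ℝ → ℝ} {g : Fin n → Space n × ℝ → ℝ}
    (h₀ : IsWeakDeriv (Q n) ((0 : Space n), (1 : ℝ)) f g₀)
    (hg : ∀ i, IsWeakDeriv (Q n) (basisVec i, (0 : ℝ)) f (g i)) {K : Set (Space n × ℝ)}
    (hK : IsCompact K) (hKQ : K ⊆ Q n) {δ r : ℝ} {h : Space n × ℝ} (hh : h ∈ upBall n δ)
    (hr : ∀ z ∈ K, ∀ s ∈ Icc (0 : ℝ) 1, z + s • h ∈ Qplus n r) :
    ∫⁻ z in K, ‖f (z + h) - f z‖ₑ ^ 2 ≤ ENNReal.ofReal (2 * δ ^ 2) *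
      ∫⁻ z in Qplus n r, ENNReal.ofReal (g₀ z ^ 2 + ∑ i, g i z ^ 2) := by
  have hh' := mem_upBall.1 hh
  have key := (isWeakDeriv_dir h₀ hg h).lintegral_translate_le isOpen_Q (fun z hz s hs => by
      rw [mem_Q] at hz ⊢
      simp only [Prod.snd_add, Prod.smul_snd, smul_eq_mul]
      have := mul_nonneg hs.1 hh'.2.1
      linarith) hK.measurableSet (measurableSet_Qplus r) hKQ (Qplus_subset_Q r) hr
  refine key.trans ?_
  rw [← lintegral_const_mul' _ _ ENNReal.ofReal_ne_top]
  refine lintegral_mono fun z => ?_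
  beta_reduce
  rw [enorm_sq_eq_ofReal, ← ENNReal.ofReal_mul (by positivity)]
  exact ENNReal.ofReal_le_ofReal
    (sq_dir_le hh'.1 (abs_le.2 ⟨by linarith [hh'.2.1, hh'.2.2], hh'.2.2⟩) _ _)

/-- Comparison of a function with its averages over the translates by `B`. Both sides carry the
factor `volume B ^ 2`, so that the average appears as the integral `∫ h in B, f (z + h)`. -/
theorem measure_sq_mul_lintegral_sq_le {f : Space n × ℝ → ℝ} (hf : Measurable f)
    {B K : Set (Space n × ℝ)} (hBfin : volume B ≠ ⊤)
    (hint : ∀ z ∈ K, IntegrableOn (fun h => f (z + h)) B) (hK : MeasurableSet K) {D : ℝ≥0∞}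
    (hB : MeasurableSet B)
    (hD : ∀ h ∈ B, ∫⁻ z in K, ‖f (z + h) - f z‖ₑ ^ 2 ≤ D) :
    volume B ^ 2 * ∫⁻ z in K, ‖f z‖ₑ ^ 2 ≤
      2 * (∫⁻ z in K, ‖∫ h in B, f (z + h)‖ₑ ^ 2) + volume B ^ 2 * (2 * D) := by
  have hm : Measurable fun p : (Space n × ℝ) × (Space n × ℝ) => f (p.1 + p.2) - f p.1 := by
    have : Continuous fun p : (Space n × ℝ) × (Space n × ℝ) => p.1 + p.2 := by fun_prop
    exact (hf.comp this.measurable).sub (hf.comp measurable_fst)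
  have hmA : Measurable fun z => ∫ h in B, f (z + h) := by
    have : Measurable fun p : (Space n × ℝ) × (Space n × ℝ) => f (p.1 + p.2) := by
      have : Continuous fun p : (Space n × ℝ) × (Space n × ℝ) => p.1 + p.2 := by fun_prop
      exact hf.comp this.measurable
    exact (this.stronglyMeasurable.integral_prod_right (ν := volume.restrict B)).measurable
  have hpt : ∀ z ∈ K, volume B ^ 2 * ‖f z‖ₑ ^ 2 ≤ 2 * ‖∫ h in B, f (z + h)‖ₑ ^ 2 +
      2 * (volume B * ∫⁻ h in B, ‖f (z + h) - f z‖ₑ ^ 2) := by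
    intro z hz
    have hfinB : IsFiniteMeasure (volume.restrict B) := ⟨by simpa using hBfin.lt_top⟩
    have e1 : ∫ h in B, (f (z + h) - f z) = (∫ h in B, f (z + h)) - (volume B).toReal * f z := by
      rw [integral_sub (hint z hz) (integrable_const _)]
      simp [Measure.real]
    have e2 : (volume B).toReal * f z =
        (∫ h in B, f (z + h)) + -(∫ h in B, (f (z + h) - f z)) := by rw [e1]; ring
    have e3 : volume B ^ 2 * ‖f z‖ₑ ^ 2 = ‖(volume B).toReal * f z‖ₑ ^ 2 := by
      rw [enorm_mul, mul_pow]
      congr 2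
      rw [Real.enorm_eq_ofReal ENNReal.toReal_nonneg, ENNReal.ofReal_toReal hBfin]
    rw [e3, e2]
    refine (enorm_add_sq_le _ _).trans ?_
    rw [enorm_neg]
    gcongr
    have := enorm_integral_sq_le (μ := volume.restrict B) (f := fun h => f (z + h) - f z)
      (hm.comp measurable_prodMk_left).aestronglyMeasurable
    simpa using this
  rw [← lintegral_const_mul' _ _ (by simp [hBfin])]
  calc ∫⁻ z in K, volume B ^ 2 * ‖f z‖ₑ ^ 2
      ≤ ∫⁻ z in K, (2 * ‖∫ h in B, f (z + h)‖ₑ ^ 2 +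
          2 * (volume B * ∫⁻ h in B, ‖f (z + h) - f z‖ₑ ^ 2)) := setLIntegral_mono' hK hpt
    _ = 2 * (∫⁻ z in K, ‖∫ h in B, f (z + h)‖ₑ ^ 2) +
          2 * (volume B * ∫⁻ z in K, ∫⁻ h in B, ‖f (z + h) - f z‖ₑ ^ 2) := by
        rw [lintegral_add_left ((hmA.enorm.pow_const 2).const_mul 2),
          lintegral_const_mul' _ _ (by simp), lintegral_const_mul' _ _ (by simp),
          lintegral_const_mul' _ _ hBfin]
    _ ≤ 2 * (∫⁻ z in K, ‖∫ h in B, f (z + h)‖ₑ ^ 2) +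
          2 * (volume B * (D * volume B)) := by
        gcongr
        rw [lintegral_lintegral_swap (hm.enorm.pow_const 2).aemeasurable]
        refine (setLIntegral_mono' hB hD).trans ?_
        simp
    _ = _ := by ring

/-- Local averages of a weakly null bounded sequence tend to `0` in `L²(K)`: they are tests against
indicator functions, so they converge pointwise, and they are bounded by Cauchy–Schwarz. -/
theorem tendsto_lintegral_average_sq {f : ℕ → Space n × ℝ → ℝ} (hf : ∀ j, Measurable (f j))
    {B K : Set (Space n × ℝ)} (hB : MeasurableSet B) (hBfin : volume B ≠ ⊤) (hK : MeasurableSet K)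
    (hKfin : volume K ≠ ⊤) {r : ℝ} (hKB : ∀ z ∈ K, ∀ h ∈ B, z + h ∈ Qplus n r)
    (hw : TendstoWeakL2 (Qplus n r) f 0) {C : ℝ≥0∞} (hC : C ≠ ⊤)
    (hfC : ∀ j, ∫⁻ z in Qplus n r, ‖f j z‖ₑ ^ 2 ≤ C) :
    Tendsto (fun j => ∫⁻ z in K, ‖∫ h in B, f j (z + h)‖ₑ ^ 2) atTop (𝓝 0) := by
  have hm : ∀ j, Measurable fun p : (Space n × ℝ) × (Space n × ℝ) => f j (p.1 + p.2) := fun j => by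
    have : Continuous fun p : (Space n × ℝ) × (Space n × ℝ) => p.1 + p.2 := by fun_prop
    exact (hf j).comp this.measurable
  have hmA : ∀ j, Measurable fun z => ∫ h in B, f j (z + h) := fun j =>
    ((hm j).stronglyMeasurable.integral_prod_right (ν := volume.restrict B)).measurable
  have hlim : ∀ z ∈ K, Tendsto (fun j => ∫ h in B, f j (z + h)) atTop (𝓝 0) := by
    intro z hz
    have hBz : MeasurableSet ((fun y => y - z) ⁻¹' B) := hB.preimage (by fun_prop)
    have h1 := hw (((fun y => y - z) ⁻¹' B).indicator 1) (by
      refine MemLp.indicator hBz ?_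
      exact memLp_const 1)
    simp only [Pi.zero_apply, zero_mul, integral_zero] at h1
    refine h1.congr fun j => ?_
    have e1 : ∀ y, f j y * ((fun y => y - z) ⁻¹' B).indicator 1 y =
        ((fun y => y - z) ⁻¹' B).indicator (f j) y := by
      intro y
      by_cases hy : y ∈ (fun y => y - z) ⁻¹' B
      · rw [indicator_of_mem hy, indicator_of_mem hy]; simp
      · rw [indicator_of_notMem hy, indicator_of_notMem hy]; simp
    simp_rw [e1]
    have hsub : (fun y => y - z) ⁻¹' B ⊆ Qplus n r := fun y hy => by
      have := hKB z hz _ hy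
      simpa using this
    rw [integral_indicator hBz, Measure.restrict_restrict hBz, inter_eq_left.2 hsub,
      ← integral_indicator hBz, ← integral_indicator hB,
      ← integral_add_left_eq_self _ z]
    congr 1
    ext h
    by_cases hh : h ∈ B
    · rw [indicator_of_mem hh, indicator_of_mem (by simpa using hh)]
    · rw [indicator_of_notMem hh, indicator_of_notMem (by simpa using hh)]
  have hbound : ∀ j, ∀ z ∈ K, ‖∫ h in B, f j (z + h)‖ₑ ^ 2 ≤ volume B * C := by
    intro j z hz
    have h1 := enorm_integral_sq_le (μ := volume.restrict B) (f := fun h => f j (z + h))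
      ((hm j).comp measurable_prodMk_left).aestronglyMeasurable
    rw [Measure.restrict_apply_univ] at h1
    refine h1.trans ?_
    gcongr
    refine le_trans ?_ (hfC j)
    have := setLIntegral_comp_add_le hB (measurableSet_Qplus r) (c := z)
      (fun h hh => by rw [add_comm]; exact hKB z hz h hh) (fun y => ‖f j y‖ₑ ^ 2)
    simpa [add_comm] using this
  have key := tendsto_lintegral_of_dominated_convergence' (μ := volume.restrict K)
    (F := fun j z => ‖∫ h in B, f j (z + h)‖ₑ ^ 2) (f := fun _ => 0) (fun _ => volume B * C)
    (fun j => ((hmA j).enorm.pow_const 2).aemeasurable)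
    (fun j => (ae_restrict_iff' hK).2 (ae_of_all _ (hbound j)))
    (by
      simp only [lintegral_const, Measure.restrict_apply_univ]
      exact ENNReal.mul_ne_top (ENNReal.mul_ne_top hBfin hC) hKfin)
    ((ae_restrict_iff' hK).2 (ae_of_all _ fun z hz => by
      have h1 := (hlim z hz).enorm
      rw [enorm_zero] at h1
      simpa using ENNReal.Tendsto.pow (n := 2) h1))
  simpa using key

/-- A form of Rellich's theorem: a weakly null sequence with locally bounded gradients tends to `0`
in `L²(K)`. -/
theorem tendsto_lintegral_sq_of_measurable {f g₀ : ℕ → Space n × ℝ → ℝ}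
    {g : ℕ → Fin n → Space n × ℝ → ℝ} (hfm : ∀ j, Measurable (f j)) (hf : ∀ j, MemL2Cyl (f j))
    (h₀ : ∀ j, IsWeakDeriv (Q n) ((0 : Space n), (1 : ℝ)) (f j) (g₀ j))
    (hg : ∀ j i, IsWeakDeriv (Q n) (basisVec i, (0 : ℝ)) (f j) (g j i))
    (hw : ∀ r, 0 < r → TendstoWeakL2 (Qplus n r) f 0)
    (hfC : ∀ r, 0 < r → ∃ C : ℝ≥0∞, C ≠ ⊤ ∧ ∀ j, ∫⁻ z in Qplus n r, ‖f j z‖ₑ ^ 2 ≤ C)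
    (hgC : ∀ r, 0 < r → ∃ C : ℝ≥0∞, C ≠ ⊤ ∧ ∀ j,
      ∫⁻ z in Qplus n r, ENNReal.ofReal (g₀ j z ^ 2 + ∑ i, g j i z ^ 2) ≤ C)
    {K : Set (Space n × ℝ)} (hK : IsCompact K) (hKQ : K ⊆ Q n) :
    Tendsto (fun j => ∫⁻ z in K, ‖f j z‖ₑ ^ 2) atTop (𝓝 0) := by
  obtain ⟨r, hr, htr⟩ := exists_Qplus_translates hK hKQ
  obtain ⟨C, hC, hfC⟩ := hfC r hr
  obtain ⟨D, hD, hgD⟩ := hgC r hr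
  rw [ENNReal.tendsto_nhds_zero]
  intro η hη
  have hη2 : 0 < η / 2 := ENNReal.half_pos hη.ne'
  obtain ⟨δ, hδD, hδ0, hδ1⟩ : ∃ δ : ℝ, 2 * (ENNReal.ofReal (2 * δ ^ 2) * D) ≤ η / 2 ∧
      0 < δ ∧ δ ≤ 1 := by
    have h1 : Tendsto (fun δ : ℝ => 2 * (ENNReal.ofReal (2 * δ ^ 2) * D)) (𝓝[>] 0) (𝓝 0) := by
      have hc : Continuous fun δ : ℝ => ENNReal.ofReal (2 * δ ^ 2) :=
        ENNReal.continuous_ofReal.comp (by fun_prop)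
      have h2 : Tendsto (fun δ : ℝ => ENNReal.ofReal (2 * δ ^ 2)) (𝓝[>] 0) (𝓝 0) := by
        have := (hc.tendsto 0).mono_left (nhdsWithin_le_nhds (s := Ioi 0))
        simpa using this
      have h3 := ENNReal.Tendsto.const_mul (a := 2)
        (ENNReal.Tendsto.mul_const h2 (Or.inr hD)) (Or.inr (by simp))
      simpa using h3
    have h2 := (ENNReal.tendsto_nhds_zero.1 h1 _ hη2).and (Ioo_mem_nhdsGT (zero_lt_one (α := ℝ)))
    obtain ⟨δ, h3, h4⟩ := h2.exists
    exact ⟨δ, h3, h4.1, h4.2.le⟩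
  set B := upBall n δ with hB
  have hBfin : volume B ≠ ⊤ := (isCompact_upBall δ).measure_lt_top.ne
  have hB0 : volume B ≠ 0 := (volume_upBall_pos hδ0).ne'
  have hBm : MeasurableSet B := (isCompact_upBall δ).measurableSet
  have hKB : ∀ z ∈ K, ∀ h ∈ B, z + h ∈ Qplus n r := fun z hz h hh => by
    simpa using htr δ hδ1 z hz h hh 1 (by simp)
  have hint : ∀ j, ∀ z ∈ K, IntegrableOn (fun h => f j (z + h)) B := fun j z hz => by
    have h1 : IntegrableOn (f j) (Qplus n r) := (hf j r hr).integrable (by norm_num)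
    have h2 := ((measurePreserving_add_left volume z).integrableOn_comp_preimage
      (measurableEmbedding_addLeft z)).2 h1
    exact h2.mono_set fun h hh => hKB z hz h hh
  have hav := tendsto_lintegral_average_sq hfm hBm hBfin hK.measurableSet hK.measure_lt_top.ne hKB
    (hw r hr) hC hfC
  have hp0 : volume B ^ 2 ≠ 0 := by simp [hB0]
  have hpt : volume B ^ 2 ≠ ⊤ := by simp [hBfin]
  -- The translates cost at most `η / 2`, uniformly in `j`; the averages do so for large `j`.
  have hav2 : ∀ᶠ j in atTop, 2 * (∫⁻ z in K, ‖∫ h in B, f j (z + h)‖ₑ ^ 2) ≤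
      volume B ^ 2 * (η / 2) := by
    have h1 := ENNReal.Tendsto.const_mul (a := 2) hav (Or.inr (by simp))
    rw [mul_zero] at h1
    exact ENNReal.tendsto_nhds_zero.1 h1 _ (ENNReal.mul_pos hp0 hη2.ne')
  filter_upwards [hav2] with j hj
  have h1 := measure_sq_mul_lintegral_sq_le (hfm j) hBfin (hint j) hK.measurableSet
    (D := ENNReal.ofReal (2 * δ ^ 2) * D) hBm (fun h hh =>
      (lintegral_translate_sub_le (h₀ j) (hg j) hK hKQ hh
        (fun z hz s hs => htr δ hδ1 z hz h hh s hs)).trans (by gcongr; exact hgD j))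
  have h2 : volume B ^ 2 * ∫⁻ z in K, ‖f j z‖ₑ ^ 2 ≤ volume B ^ 2 * η := by
    calc _ ≤ volume B ^ 2 * (η / 2) + volume B ^ 2 * (η / 2) := h1.trans (by gcongr)
      _ = _ := by rw [← mul_add, ENNReal.add_halves]
  exact (ENNReal.mul_le_mul_iff_right hp0 hpt).1 h2

/-- `tendsto_lintegral_sq_of_measurable` without pointwise measurability, by passing to measurable
representatives. -/
theorem tendsto_lintegral_sq_of_tendstoWeakL2 {f g₀ : ℕ → Space n × ℝ → ℝ}
    {g : ℕ → Fin n → Space n × ℝ → ℝ} (hf : ∀ j, MemL2Cyl (f j))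
    (h₀ : ∀ j, IsWeakDeriv (Q n) ((0 : Space n), (1 : ℝ)) (f j) (g₀ j))
    (hg : ∀ j i, IsWeakDeriv (Q n) (basisVec i, (0 : ℝ)) (f j) (g j i))
    (hw : ∀ r, 0 < r → TendstoWeakL2 (Qplus n r) f 0)
    (hfC : ∀ r, 0 < r → ∃ C : ℝ≥0∞, C ≠ ⊤ ∧ ∀ j, ∫⁻ z in Qplus n r, ‖f j z‖ₑ ^ 2 ≤ C)
    (hgC : ∀ r, 0 < r → ∃ C : ℝ≥0∞, C ≠ ⊤ ∧ ∀ j,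
      ∫⁻ z in Qplus n r, ENNReal.ofReal (g₀ j z ^ 2 + ∑ i, g j i z ^ 2) ≤ C)
    {K : Set (Space n × ℝ)} (hK : IsCompact K) (hKQ : K ⊆ Q n) :
    Tendsto (fun j => ∫⁻ z in K, ‖f j z‖ₑ ^ 2) atTop (𝓝 0) := by
  choose f' hf'm hff' using fun j => (hf j).aestronglyMeasurable
  have hf' : ∀ j, MemL2Cyl (f' j) := fun j => (hf j).congr (hff' j)
  have hres : ∀ {A : Set (Space n × ℝ)}, A ⊆ Q n → ∀ j, f j =ᵐ[volume.restrict A] f' j :=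
    fun hA j => ae_mono (Measure.restrict_mono hA le_rfl) (hff' j)
  have hl : ∀ {A : Set (Space n × ℝ)}, A ⊆ Q n → ∀ j,
      ∫⁻ z in A, ‖f j z‖ₑ ^ 2 = ∫⁻ z in A, ‖f' j z‖ₑ ^ 2 := fun hA j => by
    apply lintegral_congr_ae
    filter_upwards [hres hA j] with z hz
    rw [hz]
  simp_rw [hl hKQ]
  refine tendsto_lintegral_sq_of_measurable (fun j => (hf'm j).measurable) hf'
    (fun j => (h₀ j).congr_left (hff' j) (hf' j).locallyIntegrableOn)
    (fun j i => (hg j i).congr_left (hff' j) (hf' j).locallyIntegrableOn) ?_ ?_ hgC hK hKQ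
  · intro r hr ψ hψ
    refine (hw r hr ψ hψ).congr fun j => ?_
    apply integral_congr_ae
    filter_upwards [hres (Qplus_subset_Q r) j] with z hz
    rw [hz]
  · intro r hr
    obtain ⟨C, hC, h⟩ := hfC r hr
    exact ⟨C, hC, fun j => by rw [← hl (Qplus_subset_Q r)]; exact h j⟩

end StrongConvergence

/-! ### Compactness in `𝓤₀` -/

section Compactness

variable {n : ℕ}

/-- The function `w` together with its weak derivatives of order one, as a family indexed by `none`
(for `w`), `some none` (for `∂ₜ w`) and `some (some i)` (for `∂ᵢ w`). -/
noncomputable def jet (w : Space n × ℝ → ℝ) : Option (Option (Fin n)) → Space n × ℝ → ℝ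
  | none => w
  | some none => dt w
  | some (some i) => dx i w

theorem memL2Cyl_jet {w : Space n × ℝ → ℝ} (hw : w ∈ USpace n) :
    ∀ k, MemL2Cyl (jet w k)
  | none => hw.1
  | some none => memL2Cyl_dt hw
  | some (some i) => memL2Cyl_dx hw i

/-- The minimizers and their first derivatives are bounded in `L²` of the slabs, uniformly in `ε`,
with exponential growth in time. -/
theorem exists_lintegral_jet_slab_le {γ : ℝ} (hγ : 1 ≤ γ) {u₀ : Space n → ℝ} (hu₀ : MemH1 u₀)
    (hu₀γ : MemLp u₀ (ENNReal.ofReal γ) volume) {u : ℝ → Space n × ℝ → ℝ}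
    (hu : ∀ ε ∈ Ioo (0 : ℝ) 1, IsMinimizer γ ε u₀ (u ε)) :
    ∃ M : ℝ≥0∞, M ≠ ⊤ ∧ ∀ ε ∈ Ioo (0 : ℝ) 1, ∀ k, ∀ T, 0 < T →
      ∫⁻ z in slab n T, ‖jet (u ε) k z‖ₑ ^ 2 ≤ M * ENNReal.ofReal (Real.exp (2 * T)) := by
  obtain ⟨hmem, C, hC, hCe⟩ := exists_energy_bound hγ hu₀ hu₀γ
  set A := ∫⁻ x, ‖u₀ x‖ₑ ^ 2 with hA
  have hAfin : A ≠ ⊤ := lintegral_enorm_sq_ne_top_of_memLp hu₀.1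
  refine ⟨2 * A + 32 * C, ENNReal.add_ne_top.2 ⟨ENNReal.mul_ne_top (by simp) hAfin,
    ENNReal.mul_ne_top (by simp) hC⟩, fun ε hε k T hT => ?_⟩
  have hE : energy γ ε (u ε) ≤ C := ((hu ε hε).2 _ hmem).trans (hCe ε hε.1)
  have key := (hu ε hε).lintegral_slab_le hε hC hE hT
  have hexp : Real.exp T ≤ Real.exp (2 * T) := Real.exp_le_exp.2 (by linarith)
  have hgen : ENNReal.ofReal (Real.exp T) * (8 * C) ≤
      (2 * A + 32 * C) * ENNReal.ofReal (Real.exp (2 * T)) := by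
    rw [mul_comm]
    gcongr
    calc 8 * C ≤ 32 * C := by gcongr; norm_num
      _ ≤ 2 * A + 32 * C := le_add_self
  match k with
  | some none =>
    refine (lintegral_mono fun z => ?_).trans (key.trans hgen)
    rw [enorm_sq_eq_ofReal]
    exact le_self_add
  | some (some i) =>
    refine (lintegral_mono fun z => ?_).trans (key.trans hgen)
    rw [enorm_sq_eq_ofReal]
    refine le_trans ?_ (le_add_self.trans (le_of_eq rfl))
    refine le_trans (ENNReal.ofReal_le_ofReal ?_) le_self_add
    exact Finset.single_le_sum (f := fun i => dx i (u ε) z ^ 2) (fun i _ => sq_nonneg _)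
      (Finset.mem_univ i)
  | none =>
    refine (lintegral_slab_sq_le hu₀.1 (hu ε hε).1 hT).trans ?_
    have hdt : ∫⁻ z in slab n T, ENNReal.ofReal (dt (u ε) z ^ 2) ≤
        ENNReal.ofReal (Real.exp T) * (8 * C) :=
      (lintegral_mono fun z => le_self_add).trans key
    have h1 : T ≤ Real.exp (2 * T) := by linarith [Real.add_one_le_exp (2 * T)]
    have h2 : T ^ 2 * Real.exp T ≤ 2 * Real.exp (2 * T) := by
      have h3 := Real.quadratic_le_exp_of_nonneg hT.le
      have h4 : Real.exp (2 * T) = Real.exp T * Real.exp T := by rw [← Real.exp_add]; ring_nf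
      rw [h4]
      nlinarith [Real.exp_pos T]
    have h2' : ENNReal.ofReal (T ^ 2) * ENNReal.ofReal (Real.exp T) ≤
        2 * ENNReal.ofReal (Real.exp (2 * T)) := by
      have : (2 : ℝ≥0∞) = ENNReal.ofReal 2 := by simp
      rw [this, ← ENNReal.ofReal_mul (by positivity), ← ENNReal.ofReal_mul (by positivity)]
      exact ENNReal.ofReal_le_ofReal h2
    calc _ ≤ 2 * (ENNReal.ofReal (Real.exp (2 * T)) * A) +
          2 * (ENNReal.ofReal (T ^ 2) * (ENNReal.ofReal (Real.exp T) * (8 * C))) := by gcongr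
      _ = 2 * (ENNReal.ofReal (Real.exp (2 * T)) * A) +
          2 * ((ENNReal.ofReal (T ^ 2) * ENNReal.ofReal (Real.exp T)) * (8 * C)) := by
            rw [mul_assoc (ENNReal.ofReal (T ^ 2))]
      _ ≤ 2 * (ENNReal.ofReal (Real.exp (2 * T)) * A) +
          2 * ((2 * ENNReal.ofReal (Real.exp (2 * T))) * (8 * C)) := by gcongr
      _ = _ := by ring

/-- A sequence in `𝓤` whose jets have slab bounds of exponential growth has a subsequence whose
jets converge weakly, when tested with functions that decay fast enough in time. -/
theorem exists_subseq_tendsto_jet {U : ℕ → Space n × ℝ → ℝ} (hU : ∀ j, U j ∈ USpace n)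
    {M : ℝ≥0∞} (hM : M ≠ ⊤) (hUM : ∀ j k T, 0 < T →
      ∫⁻ z in slab n T, ‖jet (U j) k z‖ₑ ^ 2 ≤ M * ENNReal.ofReal (Real.exp (2 * T))) :
    ∃ (a : ℕ → ℕ) (V : Option (Option (Fin n)) → Space n × ℝ → ℝ), StrictMono a ∧
      (∀ k, MemL2Cyl (V k)) ∧ ∀ k (g : Space n × ℝ → ℝ),
        MemLp (fun z => Real.exp (2 * z.2) * g z) 2 (volume.restrict (Q n)) →
        Tendsto (fun j => ∫ z in Q n, jet (U (a j)) k z * g z) atTop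
          (𝓝 (∫ z in Q n, V k z * g z)) := by
  have hc1 : Continuous fun z : Space n × ℝ => Real.exp (-2 * z.2) := by fun_prop
  have hc2 : Continuous fun z : Space n × ℝ => Real.exp (2 * z.2) := by fun_prop
  have hjm : ∀ j k, AEStronglyMeasurable (jet (U j) k) (volume.restrict (Q n)) := fun j k =>
    (memL2Cyl_jet (hU j) k).aestronglyMeasurable
  set F : ℕ → Option (Option (Fin n)) → Space n × ℝ → ℝ := fun j k z =>
    Real.exp (-2 * z.2) * jet (U j) k z with hF
  have hFn : ∀ j k, eLpNorm (F j k) 2 (volume.restrict (Q n)) ≤ (2 * M) ^ (1 / 2 : ℝ) := by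
    intro j k
    rw [eLpNorm_two_eq]
    gcongr
    refine le_trans (le_of_eq ?_) (lintegral_Q_exp_neg_mul_le ((hjm j k).enorm.pow_const 2) (hUM j k))
    congr 1
    ext z
    rw [hF]
    simp only
    rw [enorm_mul, mul_pow, enorm_sq_eq_ofReal (Real.exp _), ← Real.exp_nat_mul]
    congr 3
    push_cast; ring
  have hB : (2 * M) ^ (1 / 2 : ℝ) ≠ ⊤ :=
    ENNReal.rpow_ne_top_of_nonneg (by norm_num) (ENNReal.mul_ne_top (by simp) hM)
  have hFmem : ∀ j k, MemLp (F j k) 2 (volume.restrict (Q n)) := fun j k =>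
    ⟨hc1.aestronglyMeasurable.mul (hjm j k), (hFn j k).trans_lt hB.lt_top⟩
  obtain ⟨a, G, ha, hG, hlim⟩ := exists_subseq_tendsto_weak_L2 hFmem hB hFn
  refine ⟨a, fun k z => Real.exp (2 * z.2) * G k z, ha, fun k r hr => ?_, fun k g hg => ?_⟩
  · have h1 := (hG k).mono_measure (Measure.restrict_mono (Qplus_subset_Q r) le_rfl)
    refine MemLp.of_le_mul (c := Real.exp (2 * r ^ 2)) h1 (hc2.aestronglyMeasurable.mul h1.1) ?_
    rw [ae_restrict_iff' (measurableSet_Qplus r)]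
    refine ae_of_all _ fun z hz => ?_
    rw [norm_mul, Real.norm_of_nonneg (Real.exp_pos _).le]
    gcongr
    exact hz.2.2.le
  · have h1 := hlim k _ hg
    have e1 : ∀ j z, F (a j) k z * (Real.exp (2 * z.2) * g z) = jet (U (a j)) k z * g z := by
      intro j z
      have : Real.exp (-2 * z.2) * Real.exp (2 * z.2) = 1 := by rw [← Real.exp_add]; simp
      calc _ = (Real.exp (-2 * z.2) * Real.exp (2 * z.2)) * (jet (U (a j)) k z * g z) := by
            rw [hF]; ring
        _ = _ := by rw [this, one_mul]
    have e2 : ∀ z, G k z * (Real.exp (2 * z.2) * g z) = Real.exp (2 * z.2) * G k z * g z := by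
      intro z; ring
    simp_rw [e1, e2] at h1
    exact h1

theorem memLp_exp_mul_of_hasCompactSupport {φ : Space n × ℝ → ℝ} (hφ : Continuous φ)
    (hc : HasCompactSupport φ) :
    MemLp (fun z => Real.exp (2 * z.2) * φ z) 2 (volume.restrict (Q n)) := by
  have h1 : Continuous fun z : Space n × ℝ => Real.exp (2 * z.2) * φ z := by fun_prop
  exact (h1.memLp_of_hasCompactSupport hc.mul_left).restrict _

theorem memLp_exp_mul_indicator {g : Space n × ℝ → ℝ} {r : ℝ}
    (hg : MemLp g 2 (volume.restrict (Qplus n r))) :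
    MemLp (fun z => Real.exp (2 * z.2) * (Qplus n r).indicator g z) 2
      (volume.restrict (Q n)) := by
  have e1 : (fun z : Space n × ℝ => Real.exp (2 * z.2) * (Qplus n r).indicator g z) =
      (Qplus n r).indicator fun z => Real.exp (2 * z.2) * g z := by
    ext z
    by_cases hz : z ∈ Qplus n r <;> simp [hz]
  have hc2 : Continuous fun z : Space n × ℝ => Real.exp (2 * z.2) := by fun_prop
  rw [e1, memLp_indicator_iff_restrict (measurableSet_Qplus r),
    Measure.restrict_restrict (measurableSet_Qplus r), inter_eq_left.2 (Qplus_subset_Q r)]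
  refine MemLp.of_le_mul (c := Real.exp (2 * r ^ 2)) hg (hc2.aestronglyMeasurable.mul hg.1) ?_
  rw [ae_restrict_iff' (measurableSet_Qplus r)]
  refine ae_of_all _ fun z hz => ?_
  rw [norm_mul, Real.norm_of_nonneg (Real.exp_pos _).le]
  gcongr
  exact hz.2.2.le

/-- A sequence in `𝓤₀` whose jets have slab bounds of exponential growth has a subsequence that
converges weakly in `𝓤` and in `L²_loc(Q)`, to a limit in `𝓤₀`. -/
theorem exists_subseq_tendstoWeakU {u₀ : Space n → ℝ} {U : ℕ → Space n × ℝ → ℝ}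
    (hU : ∀ j, U j ∈ USpace₀ u₀) {M : ℝ≥0∞} (hM : M ≠ ⊤) (hUM : ∀ j k T, 0 < T →
      ∫⁻ z in slab n T, ‖jet (U j) k z‖ₑ ^ 2 ≤ M * ENNReal.ofReal (Real.exp (2 * T))) :
    ∃ (a : ℕ → ℕ) (v : Space n × ℝ → ℝ), StrictMono a ∧ v ∈ USpace₀ u₀ ∧
      TendstoWeakU (fun j => U (a j)) v ∧ TendstoL2loc (fun j => U (a j)) v := by
  obtain ⟨a, V, ha, hV, hlim⟩ := exists_subseq_tendsto_jet (fun j => (hU j).1) hM hUM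
  set v := V none with hv
  have htest : ∀ k (φ : Space n × ℝ → ℝ), Continuous φ → HasCompactSupport φ →
      Tendsto (fun j => ∫ z in Q n, jet (U (a j)) k z * φ z) atTop (𝓝 (∫ z in Q n, V k z * φ z)) :=
    fun k φ hφ hc => hlim k φ (memLp_exp_mul_of_hasCompactSupport hφ hc)
  have hwd : ∀ (e : Space n × ℝ) (k), (∀ j, IsWeakDeriv (Q n) e (U j) (jet (U j) k)) →
      IsWeakDeriv (Q n) e v (V k) := by
    intro e k h
    refine ⟨(hV none).locallyIntegrableOn, (hV k).locallyIntegrableOn, fun φ hφ hc hs => ?_⟩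
    have h1 := htest none _ (continuous_fderiv_apply_const hφ e) (hasCompactSupport_fderiv_apply hc e)
    have h2 := (htest k φ hφ.continuous hc).neg
    refine tendsto_nhds_unique h1 (h2.congr fun j => ?_)
    exact ((h (a j)).2.2 φ hφ hc hs).symm
  have hvt : IsWeakDeriv (Q n) ((0 : Space n), (1 : ℝ)) v (V (some none)) :=
    hwd _ _ fun j => isWeakDeriv_dt (hU j).1
  have hvx : ∀ i, IsWeakDeriv (Q n) (basisVec i, (0 : ℝ)) v (V (some (some i))) := fun i =>
    hwd _ _ fun j => isWeakDeriv_dx (hU j).1 i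
  have hvU : v ∈ USpace n := ⟨hV none, ⟨_, hvt, hV _⟩, fun i => ⟨_, hvx i, hV _⟩⟩
  have hvU₀ : v ∈ USpace₀ u₀ := by
    refine ⟨hvU, hasInitialTrace_of_ae_eq (dt_ae_eq hvt) fun φ hφ hc => ?_⟩
    have h1 := htest none _ (continuous_fderiv_apply_const hφ ((0 : Space n), (1 : ℝ)))
      (hasCompactSupport_fderiv_apply hc _)
    have h2 := (htest (some none) φ hφ.continuous hc).neg.sub_const (∫ x, u₀ x * φ (x, 0))
    refine tendsto_nhds_unique h1 (h2.congr fun j => ?_)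
    exact ((hU (a j)).2 φ hφ hc).symm
  have hjet : ∀ k, jet v k =ᵐ[volume.restrict (Q n)] V k := fun k =>
    match k with
    | none => EventuallyEq.rfl
    | some none => dt_ae_eq hvt
    | some (some i) => dx_ae_eq (hvx i)
  have hweak : ∀ k r, TendstoWeakL2 (Qplus n r) (fun j => jet (U (a j)) k) (jet v k) := by
    intro k r g hg
    have h1 := hlim k _ (memLp_exp_mul_indicator hg)
    have e1 : ∀ f : Space n × ℝ → ℝ, ∫ z in Q n, f z * (Qplus n r).indicator g z =
        ∫ z in Qplus n r, f z * g z := by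
      intro f
      have : ∀ z, f z * (Qplus n r).indicator g z = (Qplus n r).indicator (fun z => f z * g z) z := by
        intro z
        by_cases hz : z ∈ Qplus n r <;> simp [hz]
      simp_rw [this]
      rw [integral_indicator (measurableSet_Qplus r),
        Measure.restrict_restrict (measurableSet_Qplus r), inter_eq_left.2 (Qplus_subset_Q r)]
    simp_rw [e1] at h1
    have e2 : ∫ z in Qplus n r, jet v k z * g z = ∫ z in Qplus n r, V k z * g z := by
      apply integral_congr_ae
      filter_upwards [ae_mono (Measure.restrict_mono (Qplus_subset_Q r) le_rfl) (hjet k)] with z hz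
      rw [hz]
    rw [e2]
    exact h1
  refine ⟨a, v, ha, hvU₀, fun r _ => ⟨hweak none r, hweak (some none) r,
    fun i => hweak (some (some i)) r⟩, ?_⟩
  have hbound : ∀ k r, 0 < r → ∃ C : ℝ≥0∞, C ≠ ⊤ ∧ ∀ j,
      ∫⁻ z in Qplus n r, ‖jet (U (a j)) k z - jet v k z‖ₑ ^ 2 ≤ C := by
    intro k r hr
    have hvk := memL2Cyl_jet hvU k r hr
    refine ⟨2 * (M * ENNReal.ofReal (Real.exp (2 * r ^ 2))) +
      2 * ∫⁻ z in Qplus n r, ‖jet v k z‖ₑ ^ 2, ?_, fun j => ?_⟩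
    · exact ENNReal.add_ne_top.2 ⟨ENNReal.mul_ne_top (by simp)
        (ENNReal.mul_ne_top hM ENNReal.ofReal_ne_top),
        ENNReal.mul_ne_top (by simp) (lintegral_enorm_sq_ne_top_of_memLp hvk)⟩
    · have hsub : Qplus n r ⊆ slab n (r ^ 2) := fun z hz => mem_slab.2 hz.2
      have hUk := memL2Cyl_jet (hU (a j)).1 k r hr
      calc ∫⁻ z in Qplus n r, ‖jet (U (a j)) k z - jet v k z‖ₑ ^ 2
          ≤ ∫⁻ z in Qplus n r, (2 * ‖jet (U (a j)) k z‖ₑ ^ 2 + 2 * ‖jet v k z‖ₑ ^ 2) := by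
            refine lintegral_mono fun z => ?_
            have := enorm_add_sq_le (jet (U (a j)) k z) (-jet v k z)
            rwa [enorm_neg, ← sub_eq_add_neg] at this
        _ = 2 * (∫⁻ z in Qplus n r, ‖jet (U (a j)) k z‖ₑ ^ 2) +
            2 * ∫⁻ z in Qplus n r, ‖jet v k z‖ₑ ^ 2 := by
            rw [lintegral_add_left' ((hUk.1.enorm.pow_const 2).const_mul 2),
              lintegral_const_mul' _ _ (by simp), lintegral_const_mul' _ _ (by simp)]
        _ ≤ _ := by
            gcongr
            exact (lintegral_mono_set hsub).trans (hUM (a j) k (r ^ 2) (by positivity))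
  intro K hK hKQ
  have hstrong := tendsto_lintegral_sq_of_tendstoWeakL2 (f := fun j => U (a j) - v)
    (g₀ := fun j => dt (U (a j)) - dt v) (g := fun j i => dx i (U (a j)) - dx i v)
    (fun j => MemL2Cyl.sub (hU (a j)).1.1 hvU.1)
    (fun j => (isWeakDeriv_dt (hU (a j)).1).sub (isWeakDeriv_dt hvU))
    (fun j i => (isWeakDeriv_dx (hU (a j)).1 i).sub (isWeakDeriv_dx hvU i))
    ?_ (hbound none) ?_ hK hKQ
  · have h1 := (ENNReal.continuous_rpow_const (y := (1 / 2 : ℝ))).tendsto 0 |>.comp hstrong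
    rw [ENNReal.zero_rpow_of_pos (by norm_num)] at h1
    refine h1.congr fun j => ?_
    rw [eLpNorm_two_eq]
    rfl
  · intro r hr g hg
    have h1 := (hweak none r g hg).sub_const (∫ z in Qplus n r, v z * g z)
    have e0 : (∫ z in Qplus n r, jet v none z * g z) - ∫ z in Qplus n r, v z * g z = 0 :=
      sub_self _
    rw [e0] at h1
    simp only [Pi.zero_apply, zero_mul, integral_zero]
    refine h1.congr fun j => ?_
    have i1 : Integrable (fun z => U (a j) z * g z) (volume.restrict (Qplus n r)) :=
      MemLp.integrable_mul ((hU (a j)).1.1 r hr) hg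
    have i2 : Integrable (fun z => v z * g z) (volume.restrict (Qplus n r)) :=
      MemLp.integrable_mul (hvU.1 r hr) hg
    simp only [Pi.sub_apply, sub_mul]
    rw [integral_sub i1 i2]
    rfl
  · intro r hr
    choose C hC hCb using fun k => hbound k r hr
    refine ⟨C (some none) + ∑ i, C (some (some i)), ?_, fun j => ?_⟩
    · exact ENNReal.add_ne_top.2 ⟨hC _, ENNReal.sum_ne_top.2 fun i _ => hC _⟩
    · have hm : ∀ k, AEMeasurable (fun z => ‖jet (U (a j)) k z - jet v k z‖ₑ ^ 2)
          (volume.restrict (Qplus n r)) := fun k =>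
        (((memL2Cyl_jet (hU (a j)).1 k r hr).1.sub (memL2Cyl_jet hvU k r hr).1).enorm).pow_const 2
      have e1 : ∀ z, ENNReal.ofReal ((dt (U (a j)) - dt v) z ^ 2 +
          ∑ i, (dx i (U (a j)) - dx i v) z ^ 2) =
          ‖jet (U (a j)) (some none) z - jet v (some none) z‖ₑ ^ 2 +
          ∑ i, ‖jet (U (a j)) (some (some i)) z - jet v (some (some i)) z‖ₑ ^ 2 := by
        intro z
        simp only [enorm_sq_eq_ofReal]
        rw [ENNReal.ofReal_add (sq_nonneg _) (Finset.sum_nonneg fun i _ => sq_nonneg _),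
          ENNReal.ofReal_sum_of_nonneg fun i _ => sq_nonneg _]
        rfl
      simp_rw [e1]
      rw [lintegral_add_left' (hm _), lintegral_finsetSum' _ fun i _ => hm _]
      exact add_le_add (hCb _ j) (Finset.sum_le_sum fun i _ => hCb _ j)

end Compactness

end EllipticRegularization

theorem mainTheorem5 (n : ℕ) (hn : 1 ≤ n) (γ : ℝ) (hγ₁ : 1 ≤ γ) (hγ₂ : γ < 2)
    (u₀ : Space n → ℝ) (hu₀_H1 : MemH1 u₀)
    (hu₀_Lγ : MemLp u₀ (ENNReal.ofReal γ) volume)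
    (hu₀_nonneg : ∀ᵐ x : Space n, 0 ≤ u₀ x)
    (u : ℝ → Space n × ℝ → ℝ)
    (hu : ∀ ε ∈ Ioo (0 : ℝ) 1, IsMinimizer γ ε u₀ (u ε)) :
    ∃ (v : Space n × ℝ → ℝ) (ε : ℕ → ℝ),
      v ∈ USpace₀ u₀ ∧ (∀ j, ε j ∈ Ioo (0 : ℝ) 1) ∧ Tendsto ε atTop (𝓝 0) ∧
      TendstoWeakU (fun j => u (ε j)) v ∧
      TendstoL2loc (fun j => u (ε j)) v := by
  obtain ⟨M, hM, hb⟩ := exists_lintegral_jet_slab_le hγ₁ hu₀_H1 hu₀_Lγ hu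
  set ε : ℕ → ℝ := fun j => 1 / ((j : ℝ) + 1 + 1) with hε
  have hmem : ∀ j, ε j ∈ Ioo (0 : ℝ) 1 := fun j => by
    have hj : (0 : ℝ) ≤ j := Nat.cast_nonneg j
    refine ⟨by positivity, ?_⟩
    rw [hε]
    simp only
    rw [div_lt_one (by positivity)]
    linarith
  have hlim : Tendsto ε atTop (𝓝 0) := by
    have := (tendsto_add_atTop_iff_nat 1).2 (tendsto_one_div_add_atTop_nhds_zero_nat (𝕜 := ℝ))
    refine this.congr fun j => ?_
    simp [hε]
  obtain ⟨a, v, ha, hv, hw, hs⟩ := exists_subseq_tendstoWeakU (U := fun j => u (ε j))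
    (fun j => (hu _ (hmem j)).1) hM (fun j => hb _ (hmem j))
  exact ⟨v, ε ∘ a, hv, fun j => hmem _, hlim.comp ha.tendsto_atTop, hw, hs⟩
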